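/- All Hilbert spaces are finite-dimensional. $\log$ is the logarithm to a fixed base $b>1$ and $\exp(x)=b^x$. Let $\mathcal S_\bullet(A)$ be the set of positive semi-definite operators $\rho$ on $A$ with $\operatorname{tr}\rho\le 1$. **Distances.** For operators $\xi,\zeta$ let $\Delta(\xi,\zeta)=\max_{0\le M\le 1}|\operatorname{tr}((\xi-\zeta)M)|$ (the generalized trace distance). For $\rho,\tau\in\mathcal S_\bullet(A)$ let $F_*(\rho,\tau)=\big(\operatorname{tr}|\sqrt\rho\sqrt\tau|+\sqrt{(1-\operatorname{tr}\rho)(1-\operatorname{tr}\tau)}\big)^2$ and $P(\rho,\tau)=\sqrt{1-F_*(\rho,\tau)}$ (the purified distance). **Smooth min-entropy.** For $\rho_{AB}\in\mathcal S_\bullet(AB)$ and $\varepsilon\ge 0$ let $$H_{\min}(A|B)_\rho=\sup_{\sigma_B\in\mathcal S_\bullet(B)}\sup\{\lambda\in\mathbb R:\rho_{AB}\le \exp(-\lambda)\,1_A\otimes\sigma_B\},\qquad H^{\varepsilon}_{\min}(A|B)_\rho=\sup\{H_{\min}(A|B)_{\tilde\rho}:\tilde\rho\in\mathcal S_\bullet(AB),\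 P(\tilde\rho,\rho)\le\varepsilon\},$$ with values in $[-\infty,\infty]$. **Extractable key.** Let $\rho_{ZE}=\sum_z|z\rangle\langle z|\otimes\rho_E(z)\in\mathcal S_\bullet(ZE)$ be classical on $Z$. An extraction protocol with key space $S$ is a set $\mathcal F$ of functions $f:Z\to S$ together with a probability mass function $\tau$ on $\mathcal F$; it produces $$\rho_{SEF}=\sum_{f}\tau(f)\sum_{s}|s\rangle\langle s|\otimes\Big(\sum_{z:f(z)=s}\rho_E(z)\Big)\otimes|f\rangle\langle f|,$$ and it is $\varepsilon$-secret if $\Delta(S|EF)_\rho:=\Delta(\rho_{SEF},\pi_S\otimes\rho_{EF})\le\varepsilon$, where $\pi_S=1_S/|S|$. Let $\ell^\varepsilon(Z|E)_\rho\in\{1,2,\dots\}\cup\{\infty\}$ be the supremum of all positive integers $\ell$ for which there is an $\varepsilon$-secret protocol with $|S|=\ell$. **Theorem.** Let $\rho_{ZE}\in\mathcal S_\bullet(ZE)$ be classical on $Z$ and let $\varepsilon\in(0,1)$. Then, for every $\delta\in(0,\varepsilon)$, with $\varepsilon'=\frac{\varepsilon-\delta}{2}$ and $\varepsilon''=\sqrt{2\varepsilon-\varepsilon^2}$,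 $$H_{\min}^{\varepsilon'}(Z|E)_\rho-2\log\frac1\delta\ \le\ \log\ell^{\varepsilon}(Z|E)_\rho\ \le\ H_{\min}^{\varepsilon''}(Z|E)_\rho$$ in $[-\infty,\infty]$, where $\log\infty=\infty$. Moreover, if $\varepsilon<\operatorname{tr}\rho$, then $\ell^\varepsilon(Z|E)_\rho$ is finite and is the maximum of the set of integers that defines it. -/

import Mathlib

open scoped MatrixOrder ComplexOrder Kronecker ENNReal

noncomputable section

namespace QInfo

variable {A B Z S E : Type*}

section Distances

variable [Fintype A] [DecidableEq A]

/-- Sub-normalized density operators: positive semi-definite with trace at most one. -/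
def IsSubnormalized (ρ : Matrix A A ℂ) : Prop :=
  ρ.PosSemidef ∧ ρ.trace.re ≤ 1

/-- The positive cone dual norm `‖ξ‖₊ = max {|tr (ξ M)| : 0 ≤ M ≤ 1}`. -/
def dualNorm (ξ : Matrix A A ℂ) : ℝ :=
  sSup {r : ℝ | ∃ M : Matrix A A ℂ, 0 ≤ M ∧ M ≤ 1 ∧ r = ‖(ξ * M).trace‖}

/-- Generalized trace distance; for operators of equal trace it is half the trace norm of the
difference. -/
def traceDist (ξ ζ : Matrix A A ℂ) : ℝ := dualNorm (ξ - ζ)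

/-- `tr |√ρ √τ|`, the square root of the fidelity. -/
def sqrtFidelity (ρ τ : Matrix A A ℂ) : ℝ :=
  (CFC.abs (CFC.sqrt ρ * CFC.sqrt τ)).trace.re

/-- Generalized fidelity of sub-normalized density operators. -/
def genFidelity (ρ τ : Matrix A A ℂ) : ℝ :=
  (sqrtFidelity ρ τ + Real.sqrt ((1 - ρ.trace.re) * (1 - τ.trace.re))) ^ 2

/-- Purified distance of sub-normalized density operators. -/
def purifiedDist (ρ τ : Matrix A A ℂ) : ℝ :=
  Real.sqrt (1 - genFidelity ρ τ)

end Distances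

section Entropies

variable [Fintype A] [DecidableEq A] [Fintype B] [DecidableEq B]

/-- Conditional min-entropy `H_min(A|B)` with logarithms to base `b`, the supremum of all real `t`
with `ρ ≤ b ^ (-t) 1 ⊗ σ` for some sub-normalized `σ` on `B`; for a density operator it is `⊤`
exactly if `ρ = 0`. -/
def minEntropy (b : ℝ) (ρ : Matrix (A × B) (A × B) ℂ) : EReal :=
  ⨆ (σ : Matrix B B ℂ) (_ : IsSubnormalized σ) (t : ℝ)
    (_ : ρ ≤ ((b ^ (-t) : ℝ) : ℂ) • ((1 : Matrix A A ℂ) ⊗ₖ σ)), (t : EReal)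

/-- Smooth conditional min-entropy: optimization over the sub-normalized states in the `ε`-ball
around `ρ` in purified distance. -/
def smoothMinEntropy (b ε : ℝ) (ρ : Matrix (A × B) (A × B) ℂ) : EReal :=
  ⨆ (τ : Matrix (A × B) (A × B) ℂ) (_ : IsSubnormalized τ) (_ : purifiedDist τ ρ ≤ ε),
    minEntropy b τ

end Entropies

section Marginals

/-- `ρ` on `ZE` is classical on `Z` with respect to the basis `Z`, that is, block diagonal. -/
def IsClassicalLeft (ρ : Matrix (Z × E) (Z × E) ℂ) : Prop :=
  ∀ z z' : Z, z ≠ z' → ∀ e e' : E, ρ (z, e) (z', e') = 0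

/-- The operator `ρ_E(z)` of a classical-quantum operator `∑ z, |z⟩⟨z| ⊗ ρ_E(z)`. -/
def cqBlock (ρ : Matrix (Z × E) (Z × E) ℂ) (z : Z) : Matrix E E ℂ :=
  Matrix.of fun e e' => ρ (z, e) (z, e')

/-- The marginal on the second system (partial trace over the first). -/
def marginalRight [Fintype A] (ρ : Matrix (A × B) (A × B) ℂ) : Matrix B B ℂ :=
  Matrix.of fun j j' => ∑ i, ρ (i, j) (i, j')

/-- The fully mixed state `1 / d`. -/
def fullyMixed (S : Type*) [Fintype S] [DecidableEq S] : Matrix S S ℂ :=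
  (Fintype.card S : ℂ)⁻¹ • 1

/-- `Δ(S|B)`, the trace distance of `ρ_SB` to `π_S ⊗ ρ_B`. -/
def secrecyDist [Fintype S] [DecidableEq S] [Fintype B] [DecidableEq B]
    (ρ : Matrix (S × B) (S × B) ℂ) : ℝ :=
  traceDist ρ (fullyMixed S ⊗ₖ marginalRight ρ)

end Marginals

/-- A protocol extracting a key in `S` from `Z`: a set of functions, indexing the basis of the
seed system `F`, with a probability mass function on it. -/
structure ExtractionProtocol (Z S : Type*) where
  family : Finset (Z → S)
  prob : family → ℝ
  prob_nonneg : ∀ f, 0 ≤ prob f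
  prob_sum : ∑ f, prob f = 1

section Extraction

variable [Fintype Z] [Fintype S] [DecidableEq S] [Fintype E] [DecidableEq E]

/-- `ρ_SEF = ∑ f, τ(f) ρ_SE(f) ⊗ |f⟩⟨f|` with
`ρ_SE(f) = ∑ s, |s⟩⟨s| ⊗ ∑ z, δ_{s, f(z)} ρ_E(z)`. -/
def ExtractionProtocol.output (P : ExtractionProtocol Z S) (ρ : Matrix (Z × E) (Z × E) ℂ) :
    Matrix (S × (E × P.family)) (S × (E × P.family)) ℂ :=
  ∑ f : P.family, (P.prob f : ℂ) • ∑ s : S, Matrix.single s s (1 : ℂ) ⊗ₖ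
    ((∑ z : Z, if f.1 z = s then cqBlock ρ z else 0) ⊗ₖ Matrix.single f f (1 : ℂ))

/-- `Δ(S|EF) ≤ ε`: the key is close to uniform and independent of side information and seed. -/
def ExtractionProtocol.IsSecret (P : ExtractionProtocol Z S) (ε : ℝ)
    (ρ : Matrix (Z × E) (Z × E) ℂ) : Prop :=
  secrecyDist (P.output ρ) ≤ ε

/-- An `ε`-secret key of size `ℓ` can be extracted from `Z`. -/
def IsExtractable (ε : ℝ) (ρ : Matrix (Z × E) (Z × E) ℂ) (ℓ : ℕ) : Prop :=
  0 < ℓ ∧ ∃ P : ExtractionProtocol Z (Fin ℓ), P.IsSecret ε ρ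

/-- The largest size of an `ε`-secret key, `⊤` if there are such keys of arbitrarily large size. -/
def maxKeySize (ε : ℝ) (ρ : Matrix (Z × E) (Z × E) ℂ) : ℕ∞ :=
  ⨆ (ℓ : ℕ) (_ : IsExtractable ε ρ ℓ), (ℓ : ℕ∞)

end Extraction

/-- Logarithm to base `b > 1` with `log 0 = ⊥` and `log ⊤ = ⊤`. -/
def elogb (b : ℝ) (n : ℕ∞) : EReal :=
  ENNReal.log (n : ℝ≥0∞) / ((Real.log b : ℝ) : EReal)

end QInfo

end

open scoped MatrixOrder ComplexOrder Kronecker ENNReal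

set_option linter.unusedSectionVars false

/-! ### Fidelity, polar decomposition and purified distance -/

namespace QInfo

variable {m n : Type*} [Fintype m] [DecidableEq m] [Fintype n] [DecidableEq n]

open Matrix

/-! Lower bound (leftover hashing). Let `τ` be close to `ρ` with `τ ≤ c (1 ⊗ σ)`, and hash with a
uniformly random function. For key value `s` the deviation from uniform is `ξ = ∑ z, (1[f z = s] -
1/|S|) τ_E(z)`. Values of a random function at distinct points are independent and the coefficients
are centered, so in the average of `tr (ξ σ⁻¹ ξ)` only the terms `tr (τ_E(z) σ⁻¹ τ_E(z))` survive,
and these sum to at most `c` (`sum_quadratic`, `trace_mul_inv_mul_re_le`). Completing a square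
bounds the bias of every test by this quadratic quantity (`two_mul_trace_effect_re_le`), which gives
bias at most `δ` once `c |S| ≤ 2 δ ^ 2`. Replacing `τ` by `ρ` costs the purified distance twice,
once for the real key and once for the ideal one (`abs_trace_sub_le_purifiedDist`), whence `2 (ε -
δ) / 2 + δ = ε`.

Upper bound. In an `ε`-secret protocol some single function `f` has bias at most `ε`. By
Powers–Størmer (`exists_trace_sub_le`) the root fidelity of real and ideal key is at least `tr ρ -
ε`. An Uhlmann-type argument (`exists_extension`) lifts the ideal key state along `f` to an operator
`τ` on `ZE` with `τ ≤ |S|⁻¹ (1 ⊗ ρ_E)` and no smaller fidelity to `ρ`. The first property gives `τ`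
min-entropy at least `log |S|`; the second gives generalized fidelity at least `(1 - ε) ^ 2`, that
is, purified distance at most `√(2ε - ε²)`.

Finiteness. A key computed from `Z` takes at most `|Z|` values, so testing membership in the range
of `f` exposes a key space that is too large (`card_mul_le`). -/

theorem trace_mul_re_nonneg {A B : Matrix n n ℂ} (hA : 0 ≤ A) (hB : 0 ≤ B) :
    0 ≤ (A * B).trace.re := by
  have hs : (CFC.sqrt A).PosSemidef := nonneg_iff_posSemidef.mp (CFC.sqrt_nonneg A)
  have h := ((nonneg_iff_posSemidef.mp hB).conjTranspose_mul_mul_same (CFC.sqrt A)).trace_nonneg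
  rw [hs.isHermitian.eq, Matrix.mul_assoc, trace_mul_comm, Matrix.mul_assoc,
    CFC.sqrt_mul_sqrt_self A hA, trace_mul_comm] at h
  exact (Complex.le_def.mp h).1

theorem trace_mul_re_mono {A B C : Matrix n n ℂ} (h : A ≤ B) (hC : 0 ≤ C) :
    (A * C).trace.re ≤ (B * C).trace.re := by
  have := trace_mul_re_nonneg (sub_nonneg.mpr h) hC
  rw [Matrix.sub_mul, trace_sub, Complex.sub_re] at this
  linarith

theorem trace_re_mono {A B : Matrix n n ℂ} (h : A ≤ B) : A.trace.re ≤ B.trace.re := by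
  simpa using trace_mul_re_mono h (C := 1) zero_le_one

theorem trace_re_nonneg {A : Matrix n n ℂ} (h : 0 ≤ A) : 0 ≤ A.trace.re := by
  simpa using trace_re_mono h

theorem trace_conjTranspose_mul_self_re_nonneg (X : Matrix m n ℂ) : 0 ≤ (Xᴴ * X).trace.re :=
  trace_re_nonneg (nonneg_iff_posSemidef.mpr (posSemidef_conjTranspose_mul_self X))

theorem trace_conjTranspose_re (X : Matrix n n ℂ) : Xᴴ.trace.re = X.trace.re := by
  rw [trace_conjTranspose]; exact Complex.conj_re _

theorem conj_mono {A B : Matrix n n ℂ} (h : A ≤ B) (X : Matrix m n ℂ) :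
    X * A * Xᴴ ≤ X * B * Xᴴ := by
  rw [le_iff] at *
  simpa [Matrix.mul_sub, Matrix.sub_mul] using h.mul_mul_conjTranspose_same X

theorem two_mul_trace_re_le (X Y : Matrix m n ℂ) :
    2 * (Xᴴ * Y).trace.re ≤ (Xᴴ * X).trace.re + (Yᴴ * Y).trace.re := by
  have h := trace_conjTranspose_mul_self_re_nonneg (X - Y)
  have h2 := trace_conjTranspose_re (Xᴴ * Y)
  rw [conjTranspose_mul, conjTranspose_conjTranspose] at h2
  simp only [conjTranspose_sub, Matrix.sub_mul, Matrix.mul_sub, trace_sub, Complex.sub_re] at h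
  linarith

theorem trace_conjTranspose_mul_eq (X Y : Matrix m n ℂ) :
    (Xᴴ * Y).trace = ∑ p : m × n, star (X p.1 p.2) * Y p.1 p.2 := by
  rw [Fintype.sum_prod_type, Finset.sum_comm]
  simp [trace, mul_apply]

theorem trace_re_le_sqrt_mul_sqrt (X Y : Matrix m n ℂ) :
    (Xᴴ * Y).trace.re ≤ √((Xᴴ * X).trace.re) * √((Yᴴ * Y).trace.re) := by
  have h (X : Matrix m n ℂ) : (Xᴴ * X).trace.re = ∑ p : m × n, ‖X p.1 p.2‖ ^ 2 := by
    rw [trace_conjTranspose_mul_eq, Complex.re_sum]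
    refine Finset.sum_congr rfl fun p _ => ?_
    rw [Complex.star_def, ← Complex.normSq_eq_conj_mul_self, Complex.ofReal_re,
      Complex.normSq_eq_norm_sq]
  rw [h, h]
  refine le_trans ?_ (Real.sum_mul_le_sqrt_mul_sqrt _ _ _)
  rw [trace_conjTranspose_mul_eq, Complex.re_sum]
  refine Finset.sum_le_sum fun p _ => (Complex.re_le_norm _).trans ?_
  rw [norm_mul, norm_star]

theorem projection_le_one {Q : Matrix n n ℂ} (h : Qᴴ = Q) (h2 : Q * Q = Q) : Q ≤ 1 := by
  rw [le_iff]
  have := posSemidef_conjTranspose_mul_self (1 - Q)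
  simpa [Matrix.sub_mul, Matrix.mul_sub, h, h2] using this

/-- Polar decomposition with a partial isometry. -/
theorem exists_polar (T : Matrix m n ℂ) :
    ∃ W : Matrix m n ℂ, Wᴴ * W ≤ 1 ∧ W * Wᴴ ≤ 1 ∧ Wᴴ * T = CFC.sqrt (Tᴴ * T) ∧
      W * CFC.sqrt (Tᴴ * T) = T := by
  have hT : 0 ≤ Tᴴ * T := nonneg_iff_posSemidef.mpr (posSemidef_conjTranspose_mul_self T)
  set H := CFC.sqrt (Tᴴ * T) with hH
  have hHH : H * H = Tᴴ * T := CFC.sqrt_mul_sqrt_self _ hT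
  have hH0 : 0 ≤ H := CFC.sqrt_nonneg _
  have hHs : IsSelfAdjoint H := hH0.isSelfAdjoint
  have hHt : Hᴴ = H := hHs
  set G := cfc (fun x : ℝ => x⁻¹) H with hG
  have hGt : Gᴴ = G := (cfc_predicate _ _ : IsSelfAdjoint G)
  have hcont (f : ℝ → ℝ) : ContinuousOn f (spectrum ℝ H) :=
    (Matrix.finite_real_spectrum).continuousOn f
  have hid : cfc (fun x : ℝ => x) H = H := cfc_id' ℝ H
  have hGH : cfc (fun x : ℝ => x⁻¹ * x) H = G * H := by
    rw [cfc_mul _ _ _ (hcont _) (hcont _), hid]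
  have hcomm : G * H = H * G := by
    have : cfc (fun x : ℝ => x * x⁻¹) H = H * G := by
      rw [cfc_mul _ _ _ (hcont _) (hcont _), hid]
    rw [← hGH, ← this]
    simp only [mul_comm]
  have hGHH : G * H * H = H := by
    have : cfc (fun x : ℝ => x⁻¹ * x * x) H = H := by
      conv_rhs => rw [← hid]
      congr 1; ext x; exact inv_mul_mul_self x
    rw [cfc_mul (fun x => x⁻¹ * x) _ _ (hcont _) (hcont _), cfc_mul _ _ _ (hcont _) (hcont _), hid]
      at this
    exact this
  have hGGH : G * H * G = G := by
    have : cfc (fun x : ℝ => x⁻¹ * x * x⁻¹) H = G := by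
      rw [hG]; congr 1; ext x; rcases eq_or_ne x 0 with rfl | hx <;> simp [*]
    rw [cfc_mul (fun x => x⁻¹ * x) _ _ (hcont _) (hcont _), cfc_mul _ _ _ (hcont _) (hcont _), hid]
      at this
    exact this
  have hTG : T * G * H = T := by
    -- `1 - G * H` projects onto the kernel of `H`, which is the kernel of `T` because `H * H = Tᴴ *
    -- T`.
    have h0 : (T * (1 - G * H))ᴴ * (T * (1 - G * H)) = 0 := by
      have : Tᴴ * (T * (1 - G * H)) = 0 := by
        rw [← Matrix.mul_assoc, ← hHH, Matrix.mul_sub, Matrix.mul_one, Matrix.mul_assoc H H,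
          ← Matrix.mul_assoc H G, ← hcomm, hGHH, sub_self]
      rw [conjTranspose_mul, Matrix.mul_assoc, this, Matrix.mul_zero]
    have := conjTranspose_mul_self_eq_zero.mp h0
    rw [Matrix.mul_sub, Matrix.mul_one, sub_eq_zero, ← Matrix.mul_assoc] at this
    exact this.symm
  have hWW : (T * G)ᴴ * (T * G) = G * H := by
    rw [conjTranspose_mul, hGt, Matrix.mul_assoc, ← Matrix.mul_assoc Tᴴ, ← hHH, Matrix.mul_assoc H,
      ← hcomm, ← Matrix.mul_assoc, ← Matrix.mul_assoc, hGGH]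
  have hWGH : T * G * (G * H) = T * G := by
    rw [Matrix.mul_assoc, hcomm, ← Matrix.mul_assoc G, hGGH]
  refine ⟨T * G, ?_, ?_, ?_, hTG⟩
  · rw [hWW]
    refine projection_le_one ?_ ?_
    · rw [conjTranspose_mul, hGt, hHt, hcomm]
    · rw [← Matrix.mul_assoc, hGGH]
  · refine projection_le_one ?_ ?_
    · rw [conjTranspose_mul, conjTranspose_conjTranspose]
    · rw [Matrix.mul_assoc, ← Matrix.mul_assoc _ (T * G), hWW, ← Matrix.mul_assoc, hWGH]
  · rw [conjTranspose_mul, hGt, Matrix.mul_assoc, ← hHH, ← Matrix.mul_assoc, hGHH]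

/-- With `T = W * H` polar, `tr (T C)` is the Hilbert–Schmidt inner product of `Cᴴ √H` and `W √H`,
both of squared norm at most `tr H`. -/
theorem trace_mul_re_le_trace_sqrt (T : Matrix m n ℂ) {C : Matrix n m ℂ} (hC : C * Cᴴ ≤ 1) :
    (T * C).trace.re ≤ (CFC.sqrt (Tᴴ * T)).trace.re := by
  obtain ⟨W, hW, -, -, hT⟩ := exists_polar T
  set H := CFC.sqrt (Tᴴ * T)
  have hH0 : 0 ≤ H := CFC.sqrt_nonneg _
  have hR0 : 0 ≤ CFC.sqrt H := CFC.sqrt_nonneg _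
  have hR : (CFC.sqrt H)ᴴ = CFC.sqrt H := hR0.isSelfAdjoint
  have hRR : CFC.sqrt H * CFC.sqrt H = H := CFC.sqrt_mul_sqrt_self H hH0
  have key := two_mul_trace_re_le (Cᴴ * CFC.sqrt H) (W * CFC.sqrt H)
  have e1 : ((Cᴴ * CFC.sqrt H)ᴴ * (W * CFC.sqrt H)).trace = (T * C).trace := by
    rw [conjTranspose_mul, conjTranspose_conjTranspose, hR, Matrix.mul_assoc, trace_mul_comm,
      Matrix.mul_assoc, Matrix.mul_assoc, hRR, hT, trace_mul_comm]
  have e2 : ((Cᴴ * CFC.sqrt H)ᴴ * (Cᴴ * CFC.sqrt H)).trace = (C * Cᴴ * H).trace := by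
    rw [conjTranspose_mul, conjTranspose_conjTranspose, hR, Matrix.mul_assoc, trace_mul_comm,
      ← Matrix.mul_assoc, Matrix.mul_assoc, hRR]
  have e3 : ((W * CFC.sqrt H)ᴴ * (W * CFC.sqrt H)).trace = (Wᴴ * W * H).trace := by
    rw [conjTranspose_mul, hR, Matrix.mul_assoc, trace_mul_comm, ← Matrix.mul_assoc,
      Matrix.mul_assoc, hRR]
  rw [e1, e2, e3] at key
  have h1 := trace_mul_re_mono hC hH0
  have h2 := trace_mul_re_mono hW hH0
  rw [Matrix.one_mul] at h1 h2
  linarith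

theorem conjTranspose_sqrt (A : Matrix n n ℂ) : (CFC.sqrt A)ᴴ = CFC.sqrt A :=
  (CFC.sqrt_nonneg A).isSelfAdjoint

theorem sqrtFidelity_eq (A B : Matrix n n ℂ) :
    sqrtFidelity A B =
      (CFC.sqrt ((CFC.sqrt A * CFC.sqrt B)ᴴ * (CFC.sqrt A * CFC.sqrt B))).trace.re := rfl

/-- The polar decomposition of `Lᴴ` turns `L` into `√(L Lᴴ) Wᴴ` with `W` a contraction, so the
variational bound for `tr |√(L Lᴴ) √A|` applies. This is the counterpart to the extension half of
Uhlmann's theorem: any factor `L` certifies a fidelity. -/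
theorem trace_sqrt_mul_le_sqrtFidelity (A L : Matrix n n ℂ) :
    (CFC.sqrt A * L).trace.re ≤ sqrtFidelity (L * Lᴴ) A := by
  obtain ⟨W, hW, hW', -, hL⟩ := exists_polar Lᴴ
  rw [conjTranspose_conjTranspose] at hL
  have h := trace_mul_re_le_trace_sqrt (CFC.sqrt (L * Lᴴ) * CFC.sqrt A) hW'
  rw [← sqrtFidelity_eq] at h
  refine le_of_eq_of_le ?_ h
  generalize CFC.sqrt (L * Lᴴ) = H at hL ⊢
  rw [← trace_conjTranspose_re, conjTranspose_mul, conjTranspose_sqrt, ← hL, Matrix.mul_assoc,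
    trace_mul_comm]

/-- The extension half of Uhlmann's theorem. -/
theorem exists_trace_eq_sqrtFidelity (K : Matrix n m ℂ) {B : Matrix n n ℂ} (hB : 0 ≤ B) :
    ∃ L : Matrix n m ℂ, L * Lᴴ ≤ B ∧ (Kᴴ * L).trace.re = sqrtFidelity (K * Kᴴ) B := by
  obtain ⟨W, hW, -, hT, -⟩ := exists_polar (Kᴴ * CFC.sqrt B)
  -- `W` is the polar part of `Kᴴ √B`, so `Wᴴ` aligns the phases and the trace becomes `tr |Kᴴ √B|`.
  -- As `W` is only a partial isometry, `L * Lᴴ` can fall short of `B`.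
  refine ⟨CFC.sqrt B * Wᴴ, ?_, ?_⟩
  · have := conj_mono hW (CFC.sqrt B)
    rw [Matrix.mul_one, conjTranspose_sqrt, CFC.sqrt_mul_sqrt_self B hB] at this
    rwa [conjTranspose_mul, conjTranspose_conjTranspose, conjTranspose_sqrt, ← Matrix.mul_assoc,
      Matrix.mul_assoc (CFC.sqrt B)]
  · have hK : 0 ≤ K * Kᴴ := nonneg_iff_posSemidef.mpr (posSemidef_self_mul_conjTranspose K)
    rw [← Matrix.mul_assoc, trace_mul_comm, hT, sqrtFidelity_eq]
    congr 3
    rw [conjTranspose_mul, conjTranspose_mul, conjTranspose_conjTranspose, conjTranspose_sqrt,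
      conjTranspose_sqrt, Matrix.mul_assoc, Matrix.mul_assoc, ← Matrix.mul_assoc K,
      ← Matrix.mul_assoc (CFC.sqrt (K * Kᴴ)), CFC.sqrt_mul_sqrt_self _ hK]

/-- A form of the Powers–Størmer inequality. -/
theorem exists_trace_sub_le {A B : Matrix n n ℂ} (hA : 0 ≤ A) (hB : 0 ≤ B)
    (hAB : A.trace = B.trace) :
    ∃ M : Matrix n n ℂ, 0 ≤ M ∧ M ≤ 1 ∧
      A.trace.re - sqrtFidelity A B ≤ ((A - B) * M).trace.re := by
  set R := CFC.sqrt A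
  set S := CFC.sqrt B
  have hR : 0 ≤ R := CFC.sqrt_nonneg _
  have hS : 0 ≤ S := CFC.sqrt_nonneg _
  have hRR : R * R = A := CFC.sqrt_mul_sqrt_self A hA
  have hSS : S * S = B := CFC.sqrt_mul_sqrt_self B hB
  have hX : IsSelfAdjoint (R - S) := hR.isSelfAdjoint.sub hS.isSelfAdjoint
  obtain ⟨X, hXdef⟩ : ∃ X, X = R - S := ⟨_, rfl⟩
  rw [← hXdef] at hX
  have hcont (f : ℝ → ℝ) : ContinuousOn f (spectrum ℝ X) :=
    (Matrix.finite_real_spectrum).continuousOn f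
  -- The test `M` is the spectral projection onto the positive part of `X = √A - √B`; `X * M` and `X
  -- * M - X` are the positive and negative parts of `X`.
  set u : ℝ → ℝ := fun x => if 0 < x then 1 else 0
  set M := cfc u X with hM
  have hid : cfc (fun x : ℝ => x) X = X := cfc_id' ℝ X
  have e1 : cfc (fun x : ℝ => x * u x) X = X * M := by
    rw [cfc_mul _ _ _ (hcont _) (hcont _), hid]
  have e2 : cfc (fun x : ℝ => u x * x) X = M * X := by
    rw [cfc_mul _ _ _ (hcont _) (hcont _), hid]
  have hcomm : M * X = X * M := by rw [← e1, ← e2]; simp only [mul_comm]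
  have e3 : cfc (fun x : ℝ => x * u x - x) X = X * M - X := by
    rw [cfc_sub _ _ _ (hcont _) (hcont _), e1, hid]
  have h1 : 0 ≤ X * M := by
    rw [← e1]
    refine cfc_nonneg fun x _ => ?_
    simp only [u]; split_ifs with h
    · simpa using h.le
    · simp
  have h2 : 0 ≤ X * M - X := by
    rw [← e3]
    refine cfc_nonneg fun x _ => ?_
    simp only [u]; split_ifs with h
    · simp
    · simpa using h
  have hsq : A - B = (1 / 2 : ℂ) • (X * (R + S) + (R + S) * X) := by
    rw [← hRR, ← hSS, hXdef]
    have : (R - S) * (R + S) + (R + S) * (R - S) = (2 : ℂ) • (R * R - S * S) := by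
      rw [two_smul]; noncomm_ring
    rw [this, smul_smul]; norm_num
  have htr : ((A - B) * M).trace = ((R + S) * (X * M)).trace := by
    rw [hsq, Matrix.smul_mul, trace_smul, Matrix.add_mul, trace_add, Matrix.mul_assoc,
      trace_mul_comm X, Matrix.mul_assoc, hcomm, Matrix.mul_assoc, smul_eq_mul]
    ring
  have htr2 : ((R + S) * X).trace = 0 := by
    have : (A - B).trace = ((R + S) * X).trace := by
      rw [hsq, trace_smul, trace_add, trace_mul_comm X, smul_eq_mul]; ring
    rw [← this, trace_sub, hAB, sub_self]
  refine ⟨M, cfc_nonneg fun x _ => ?_, cfc_le_one _ _ fun x _ => ?_, ?_⟩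
  · simp only [u]; split_ifs <;> norm_num
  · simp only [u]; split_ifs <;> norm_num
  -- Testing `X ≤ R + S` on the positive part and `-X ≤ R + S` on the negative part and adding gives
  -- `tr X² ≤ 2 tr ((A - B) M)`; equality of the traces removes `tr ((R + S) X)`.
  have hle1 : X ≤ R + S := by
    rw [hXdef, sub_eq_add_neg]; exact add_le_add_right ((neg_nonpos.mpr hS).trans hS) R
  have hle2 : -X ≤ R + S := by
    rw [hXdef, neg_sub, sub_eq_add_neg, add_comm]
    exact add_le_add_left ((neg_nonpos.mpr hR).trans hR) S
  have k1 := trace_mul_re_mono hle1 h1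
  have k2 := trace_mul_re_mono hle2 h2
  have hXX : (X * X).trace.re = A.trace.re + B.trace.re - 2 * (R * S).trace.re := by
    have : X * X = A + B - R * S - S * R := by rw [← hRR, ← hSS, hXdef]; noncomm_ring
    rw [this, trace_sub, trace_sub, trace_add, trace_mul_comm S R]
    simp only [Complex.sub_re, Complex.add_re]; ring
  have hf : (R * S).trace.re ≤ sqrtFidelity A B := by
    have := trace_mul_re_le_trace_sqrt (R * S) (C := 1) (by simp)
    rwa [Matrix.mul_one] at this
  rw [Matrix.mul_sub, Matrix.mul_sub, trace_sub, trace_sub, htr2, sub_zero, Matrix.neg_mul,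
    Matrix.neg_mul, trace_neg, trace_neg] at k2
  simp only [Complex.sub_re, Complex.neg_re] at k2
  rw [htr]
  rw [← hAB] at hXX
  linarith

/-- Measuring `{M, 1 - M}` cannot decrease the fidelity: insert `1 = M + (1 - M)` between the roots
in `tr Wᴴ √A √B` and apply Cauchy–Schwarz to each summand. -/
theorem sqrtFidelity_le {A B M : Matrix n n ℂ} (hA : 0 ≤ A) (hB : 0 ≤ B) (hM : 0 ≤ M)
    (hM1 : M ≤ 1) :
    sqrtFidelity A B ≤ √(A * M).trace.re * √(B * M).trace.re +
      √(A * (1 - M)).trace.re * √(B * (1 - M)).trace.re := by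
  obtain ⟨W, -, hW, hT, -⟩ := exists_polar (CFC.sqrt A * CFC.sqrt B)
  have aux {N : Matrix n n ℂ} (hN : 0 ≤ N) :
      (Wᴴ * (CFC.sqrt A * N * CFC.sqrt B)).trace.re ≤
        √(A * N).trace.re * √(B * N).trace.re := by
    set Q := CFC.sqrt N
    have hQ : Qᴴ = Q := conjTranspose_sqrt N
    have hQQ : Q * Q = N := CFC.sqrt_mul_sqrt_self N hN
    have h := trace_re_le_sqrt_mul_sqrt (Q * CFC.sqrt A * W) (Q * CFC.sqrt B)
    have e1 : (Q * CFC.sqrt A * W)ᴴ * (Q * CFC.sqrt B) =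
        Wᴴ * (CFC.sqrt A * N * CFC.sqrt B) := by
      simp only [conjTranspose_mul, hQ, conjTranspose_sqrt, ← hQQ, Matrix.mul_assoc]
    have e2 : ((Q * CFC.sqrt B)ᴴ * (Q * CFC.sqrt B)).trace = (B * N).trace := by
      rw [conjTranspose_mul, hQ, conjTranspose_sqrt, Matrix.mul_assoc, trace_mul_comm,
        ← Matrix.mul_assoc Q, hQQ, Matrix.mul_assoc, CFC.sqrt_mul_sqrt_self B hB, trace_mul_comm]
    have e3 : ((Q * CFC.sqrt A * W)ᴴ * (Q * CFC.sqrt A * W)).trace.re ≤ (A * N).trace.re := by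
      rw [trace_mul_comm]
      have := trace_re_mono (conj_mono hW (Q * CFC.sqrt A))
      have e4 : (Q * CFC.sqrt A * (Q * CFC.sqrt A)ᴴ).trace = (A * N).trace := by
        rw [conjTranspose_mul, hQ, conjTranspose_sqrt, Matrix.mul_assoc Q,
          ← Matrix.mul_assoc (CFC.sqrt A) (CFC.sqrt A), CFC.sqrt_mul_sqrt_self A hA,
          trace_mul_comm Q, Matrix.mul_assoc A, hQQ]
      rw [Matrix.mul_one, e4] at this
      refine le_of_eq_of_le ?_ this
      simp only [conjTranspose_mul, hQ, conjTranspose_sqrt, Matrix.mul_assoc]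
    rw [e1, e2] at h
    exact h.trans (mul_le_mul_of_nonneg_right (Real.sqrt_le_sqrt e3) (Real.sqrt_nonneg _))
  have h1 := aux hM
  have h2 := aux (sub_nonneg.mpr hM1)
  have : sqrtFidelity A B = (Wᴴ * (CFC.sqrt A * M * CFC.sqrt B)).trace.re +
      (Wᴴ * (CFC.sqrt A * (1 - M) * CFC.sqrt B)).trace.re := by
    rw [sqrtFidelity_eq, ← hT, ← Complex.add_re, ← trace_add, ← Matrix.mul_add, ← Matrix.add_mul,
      ← Matrix.mul_add, add_sub_cancel, Matrix.mul_one]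
  linarith

theorem sqrtFidelity_nonneg (A B : Matrix n n ℂ) : 0 ≤ sqrtFidelity A B :=
  trace_re_nonneg (CFC.sqrt_nonneg _)

theorem IsSubnormalized.nonneg {A : Matrix n n ℂ} (h : IsSubnormalized A) : 0 ≤ A :=
  nonneg_iff_posSemidef.mpr h.1

/-- Purified distance dominates the bias of every measurement. -/
theorem abs_trace_sub_le_purifiedDist {A B M : Matrix n n ℂ} (hA : IsSubnormalized A)
    (hB : IsSubnormalized B) (hM : 0 ≤ M) (hM1 : M ≤ 1) :
    |((A - B) * M).trace.re| ≤ purifiedDist A B := by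
  refine Real.abs_le_sqrt ?_
  have hM2 : 0 ≤ 1 - M := sub_nonneg.mpr hM1
  have hF := sqrtFidelity_le hA.nonneg hB.nonneg hM hM1
  have hF0 := sqrtFidelity_nonneg A B
  have hs (A : Matrix n n ℂ) : (A * (1 - M)).trace.re = A.trace.re - (A * M).trace.re := by
    rw [Matrix.mul_sub, Matrix.mul_one, trace_sub, Complex.sub_re]
  have a1 := trace_mul_re_nonneg hA.nonneg hM
  have b1 := trace_mul_re_nonneg hB.nonneg hM
  have a2 := trace_mul_re_nonneg hA.nonneg hM2
  have b2 := trace_mul_re_nonneg hB.nonneg hM2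
  have a3 : 0 ≤ 1 - A.trace.re := sub_nonneg.mpr hA.2
  have b3 : 0 ≤ 1 - B.trace.re := sub_nonneg.mpr hB.2
  rw [Matrix.sub_mul, trace_sub, Complex.sub_re, genFidelity, Real.sqrt_mul a3]
  have ha := hs A
  have hb := hs B
  generalize (A * M).trace.re = p at *
  generalize (B * M).trace.re = q at *
  generalize (A * (1 - M)).trace.re = p' at *
  generalize (B * (1 - M)).trace.re = q' at *
  generalize A.trace.re = a at *
  generalize B.trace.re = b at *
  -- The outcome `1 - M` and the missing weight `1 - tr` are merged into one outcome by
  -- Cauchy–Schwarz in the plane, since `p' + (1 - a) = 1 - p`.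
  have cs : √p' * √q' + √(1 - a) * √(1 - b) ≤ √(1 - p) * √(1 - q) := by
    rw [← Real.sqrt_mul (x := 1 - p) (by linarith)]
    refine Real.le_sqrt_of_sq_le ?_
    have e1 := Real.sq_sqrt a2
    have e2 := Real.sq_sqrt b2
    have e3 := Real.sq_sqrt a3
    have e4 := Real.sq_sqrt b3
    have : (1 - p) * (1 - q) = (√p' ^ 2 + √(1 - a) ^ 2) * (√q' ^ 2 + √(1 - b) ^ 2) := by
      rw [e1, e2, e3, e4, ha, hb]; ring
    rw [this]
    nlinarith [sq_nonneg (√p' * √(1 - b) - √(1 - a) * √q')]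
  have hx := Real.sq_sqrt a1
  have hy := Real.sq_sqrt b1
  have hx' := Real.sq_sqrt (show 0 ≤ 1 - p by linarith)
  have hy' := Real.sq_sqrt (show 0 ≤ 1 - q by linarith)
  have hu : sqrtFidelity A B + √(1 - a) * √(1 - b) ≤ √p * √q + √(1 - p) * √(1 - q) := by linarith
  have hu2 := pow_le_pow_left₀ (by positivity) hu 2
  generalize √p = x at *
  generalize √q = y at *
  generalize √(1 - p) = x' at *
  generalize √(1 - q) = y' at *
  -- For the unit vectors `(x, x')` and `(y, y')` at angles `α` and `β`, the two factors are, up to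
  -- sign, the sines of `α - β` and `α + β`, while `x y + x' y'` is `cos (α - β)`.
  have hpq : p - q = (x * y' - x' * y) * (x * y' + x' * y) := by
    have : p - q = x ^ 2 * y' ^ 2 - x' ^ 2 * y ^ 2 := by rw [hx, hy, hx', hy']; ring
    rw [this]; ring
  have h1 : (x * y + x' * y') ^ 2 + (x * y' - x' * y) ^ 2 = 1 := by
    have : (x ^ 2 + x' ^ 2) * (y ^ 2 + y' ^ 2) = 1 := by rw [hx, hy, hx', hy']; ring
    linarith
  have h2 : (x * y' + x' * y) ^ 2 ≤ 1 := by
    have : (x ^ 2 + x' ^ 2) * (y' ^ 2 + y ^ 2) = 1 := by rw [hx, hy, hx', hy']; ring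
    nlinarith [sq_nonneg (x * y - x' * y')]
  have h3 : (p - q) ^ 2 ≤ (x * y' - x' * y) ^ 2 := by
    rw [hpq, mul_pow]
    exact mul_le_of_le_one_right (sq_nonneg _) h2
  linarith

end QInfo

/-! ### Classical-quantum operators and secrecy conditioned on the seed -/

namespace QInfo

open Matrix

variable {Z S E F : Type*} [Fintype Z] [DecidableEq Z] [Fintype S] [DecidableEq S] [Fintype E]
  [DecidableEq E]

/-- The block-diagonal operator `∑ z, |z⟩⟨z| ⊗ r z`. -/
def cqMatrix (r : Z → Matrix E E ℂ) : Matrix (Z × E) (Z × E) ℂ :=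
  Matrix.of fun x y => if x.1 = y.1 then r x.1 x.2 y.2 else 0

/-- The operator on `E` conditioned on the key `f z = s`. -/
def keyBlock (f : Z → S) (ρ : Matrix (Z × E) (Z × E) ℂ) (s : S) : Matrix E E ℂ :=
  ∑ z : Z, if f z = s then cqBlock ρ z else 0

/-- The joint state of the key `f z` and the side information. -/
def keyState (f : Z → S) (ρ : Matrix (Z × E) (Z × E) ℂ) : Matrix (S × E) (S × E) ℂ :=
  cqMatrix (keyBlock f ρ)

/-- A uniform key, independent of the side information. -/
noncomputable def idealState (S : Type*) [Fintype S] [DecidableEq S] (ρ : Matrix (Z × E) (Z × E) ℂ) :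
    Matrix (S × E) (S × E) ℂ :=
  cqMatrix fun _ => (Fintype.card S : ℂ)⁻¹ • marginalRight ρ

/-- The diagonal block of an operator at a fixed seed. -/
def seedBlock (M : Matrix (S × (E × F)) (S × (E × F)) ℂ) (f : F) : Matrix (S × E) (S × E) ℂ :=
  M.submatrix (fun x => (x.1, (x.2, f))) (fun x => (x.1, (x.2, f)))

theorem marginalRight_eq_sum (ρ : Matrix (Z × E) (Z × E) ℂ) :
    marginalRight ρ = ∑ z, cqBlock ρ z := by
  ext i j
  simp [marginalRight, cqBlock, Matrix.sum_apply]

theorem keyBlock_apply (f : Z → S) (ρ : Matrix (Z × E) (Z × E) ℂ) (s : S) (e e' : E) :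
    keyBlock f ρ s e e' = ∑ z : Z, if f z = s then ρ (z, e) (z, e') else 0 := by
  rw [keyBlock, Matrix.sum_apply]
  refine Finset.sum_congr rfl fun z _ => ?_
  split_ifs <;> rfl

theorem sum_keyBlock (f : Z → S) (ρ : Matrix (Z × E) (Z × E) ℂ) :
    ∑ s, keyBlock f ρ s = marginalRight ρ := by
  simp_rw [keyBlock, marginalRight_eq_sum]
  rw [Finset.sum_comm]
  simp

variable (P : ExtractionProtocol Z S)

theorem ExtractionProtocol.output_apply (ρ : Matrix (Z × E) (Z × E) ℂ)
    (x y : S × (E × P.family)) :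
    P.output ρ x y = if x.2.2 = y.2.2 then
      P.prob x.2.2 * keyState x.2.2.1 ρ (x.1, x.2.1) (y.1, y.2.1) else 0 := by
  obtain ⟨s, e, f⟩ := x
  obtain ⟨s', e', f'⟩ := y
  have h (g : P.family) (t : S) : (Matrix.single t t (1 : ℂ) ⊗ₖ
      ((∑ z : Z, if g.1 z = t then cqBlock ρ z else 0) ⊗ₖ Matrix.single g g (1 : ℂ)))
        (s, e, f) (s', e', f') =
      if t = s then (if g = f then (if s = s' ∧ f = f' then keyBlock g.1 ρ t e e' else 0)
        else 0) else 0 := by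
    rw [kroneckerMap_apply, kroneckerMap_apply, ← keyBlock]
    simp only [Matrix.single_apply]
    split_ifs <;> simp_all
  simp only [ExtractionProtocol.output, Matrix.sum_apply, Matrix.smul_apply, h]
  simp only [Finset.sum_ite_eq', Finset.mem_univ, if_true, smul_eq_mul, mul_ite, mul_zero]
  simp only [keyState, cqMatrix, Matrix.of_apply]
  split_ifs <;> simp_all

theorem ExtractionProtocol.output_sub_apply (ρ : Matrix (Z × E) (Z × E) ℂ)
    (x y : S × (E × P.family)) :
    (P.output ρ - fullyMixed S ⊗ₖ marginalRight (P.output ρ)) x y = if x.2.2 = y.2.2 then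
      P.prob x.2.2 * (keyState x.2.2.1 ρ - idealState S ρ) (x.1, x.2.1) (y.1, y.2.1) else 0 := by
  have h : marginalRight (P.output ρ) x.2 y.2 = if x.2.2 = y.2.2 then
      P.prob x.2.2 * marginalRight ρ x.2.1 y.2.1 else 0 := by
    simp only [marginalRight, Matrix.of_apply, P.output_apply]
    split_ifs with h
    · rw [← Finset.mul_sum]
      have := congrFun (congrFun (sum_keyBlock x.2.2.1 ρ) x.2.1) y.2.1
      rw [Matrix.sum_apply] at this
      simp only [keyState, cqMatrix, Matrix.of_apply, if_true, this]
      rfl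
    · simp
  rw [Matrix.sub_apply, P.output_apply, kroneckerMap_apply, h]
  simp only [fullyMixed, Matrix.smul_apply, Matrix.one_apply, Matrix.sub_apply, idealState,
    cqMatrix, Matrix.of_apply]
  split_ifs <;> simp
  ring

/-- The operator is block diagonal in the seed register, so a test acts only through its diagonal
seed blocks. -/
theorem ExtractionProtocol.trace_output_sub_mul (ρ : Matrix (Z × E) (Z × E) ℂ)
    (M : Matrix (S × (E × P.family)) (S × (E × P.family)) ℂ) :
    ((P.output ρ - fullyMixed S ⊗ₖ marginalRight (P.output ρ)) * M).trace =
      ∑ f, P.prob f * ((keyState f.1 ρ - idealState S ρ) * seedBlock M f).trace := by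
  simp only [trace, diag_apply, mul_apply, P.output_sub_apply, seedBlock, submatrix_apply,
    Fintype.sum_prod_type, ite_mul, zero_mul, Finset.sum_ite_eq, Finset.mem_univ, if_true,
    Finset.mul_sum, mul_assoc]
  rw [Finset.sum_comm' (t' := Finset.univ) (s' := fun _ => Finset.univ) (by simp)]
  conv_lhs =>
    enter [2, x]
    rw [Finset.sum_comm]
  rw [Finset.sum_comm]
  refine Finset.sum_congr rfl fun f _ => ?_
  rw [Finset.sum_comm]

theorem cqMatrix_eq_sum (r : Z → Matrix E E ℂ) :
    cqMatrix r = ∑ z, Matrix.single z z (1 : ℂ) ⊗ₖ r z := by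
  ext ⟨z, e⟩ ⟨z', e'⟩
  simp only [cqMatrix, Matrix.of_apply, Matrix.sum_apply, kroneckerMap_apply, Matrix.single_apply,
    ite_mul, one_mul, zero_mul]
  split_ifs with h
  · subst h; simp
  · refine (Finset.sum_eq_zero fun t _ => if_neg ?_).symm
    rintro ⟨rfl, rfl⟩; exact h rfl

theorem cqMatrix_nonneg {r : Z → Matrix E E ℂ} (h : ∀ z, 0 ≤ r z) : 0 ≤ cqMatrix r := by
  rw [cqMatrix_eq_sum]
  refine Finset.sum_nonneg fun z _ => nonneg_iff_posSemidef.mpr ?_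
  refine PosSemidef.kronecker ?_ (nonneg_iff_posSemidef.mp (h z))
  have := posSemidef_conjTranspose_mul_self (Matrix.single z z (1 : ℂ))
  simpa using this

theorem cqMatrix_sub (r t : Z → Matrix E E ℂ) :
    cqMatrix (fun z => r z - t z) = cqMatrix r - cqMatrix t := by
  ext x y
  simp only [cqMatrix, Matrix.of_apply, Matrix.sub_apply]
  split_ifs <;> simp

theorem cqMatrix_mono {r t : Z → Matrix E E ℂ} (h : ∀ z, r z ≤ t z) :
    cqMatrix r ≤ cqMatrix t := by
  rw [← sub_nonneg, ← cqMatrix_sub]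
  exact cqMatrix_nonneg fun z => sub_nonneg.mpr (h z)

theorem cqMatrix_one : cqMatrix (fun _ : Z => (1 : Matrix E E ℂ)) = 1 := by
  ext ⟨z, e⟩ ⟨z', e'⟩
  simp only [cqMatrix, Matrix.of_apply, Matrix.one_apply, Prod.mk.injEq]
  split_ifs <;> simp_all

theorem trace_cqMatrix (r : Z → Matrix E E ℂ) : (cqMatrix r).trace = ∑ z, (r z).trace := by
  simp [trace, cqMatrix, Fintype.sum_prod_type]

theorem trace_cqMatrix_mul (r : Z → Matrix E E ℂ) (M : Matrix (Z × E) (Z × E) ℂ) :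
    (cqMatrix r * M).trace = ∑ z, (r z * cqBlock M z).trace := by
  simp only [trace, diag_apply, mul_apply, cqMatrix, cqBlock, Matrix.of_apply,
    Fintype.sum_prod_type, ite_mul, zero_mul]
  refine Finset.sum_congr rfl fun z _ => Finset.sum_congr rfl fun e _ => ?_
  rw [Finset.sum_comm]
  simp

theorem trace_mul_cqMatrix (M : Matrix (Z × E) (Z × E) ℂ) (r : Z → Matrix E E ℂ) :
    (M * cqMatrix r).trace = ∑ z, (cqBlock M z * r z).trace := by
  rw [trace_mul_comm, trace_cqMatrix_mul]
  exact Finset.sum_congr rfl fun z _ => trace_mul_comm _ _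

theorem cqBlock_mono {M N : Matrix (Z × E) (Z × E) ℂ} (h : M ≤ N) (z : Z) :
    cqBlock M z ≤ cqBlock N z :=
  le_iff.mpr ((le_iff.mp h).submatrix (fun e => (z, e)))

theorem cqBlock_one (z : Z) : cqBlock (1 : Matrix (Z × E) (Z × E) ℂ) z = 1 := by
  ext e e'
  simp [cqBlock, Matrix.one_apply]

theorem cqBlock_nonneg {M : Matrix (Z × E) (Z × E) ℂ} (h : 0 ≤ M) (z : Z) : 0 ≤ cqBlock M z :=
  cqBlock_mono h z

theorem cqBlock_le_one {M : Matrix (Z × E) (Z × E) ℂ} (h : M ≤ 1) (z : Z) : cqBlock M z ≤ 1 :=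
  (cqBlock_mono h z).trans_eq (cqBlock_one z)

theorem sum_trace_cqBlock (M : Matrix (Z × E) (Z × E) ℂ) :
    ∑ z, (cqBlock M z).trace = M.trace := by
  simp [trace, cqBlock, Fintype.sum_prod_type]

theorem trace_marginalRight (ρ : Matrix (Z × E) (Z × E) ℂ) :
    (marginalRight ρ).trace = ρ.trace := by
  rw [marginalRight_eq_sum, trace_sum, sum_trace_cqBlock]

theorem marginalRight_nonneg {ρ : Matrix (Z × E) (Z × E) ℂ} (h : 0 ≤ ρ) : 0 ≤ marginalRight ρ := by
  rw [marginalRight_eq_sum]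
  exact Finset.sum_nonneg fun z _ => cqBlock_nonneg h z

theorem keyBlock_nonneg (f : Z → S) {ρ : Matrix (Z × E) (Z × E) ℂ} (h : 0 ≤ ρ) (s : S) :
    0 ≤ keyBlock f ρ s :=
  Finset.sum_nonneg fun z _ => by
    split_ifs
    · exact cqBlock_nonneg h z
    · exact le_rfl

theorem keyState_nonneg (f : Z → S) {ρ : Matrix (Z × E) (Z × E) ℂ} (h : 0 ≤ ρ) :
    0 ≤ keyState f ρ :=
  cqMatrix_nonneg (keyBlock_nonneg f h)

theorem smul_nonneg_matrix {A : Matrix E E ℂ} (h : 0 ≤ A) {c : ℂ} (hc : 0 ≤ c) : 0 ≤ c • A :=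
  nonneg_iff_posSemidef.mpr ((nonneg_iff_posSemidef.mp h).smul hc)

theorem inv_natCast_nonneg (n : ℕ) : (0 : ℂ) ≤ (n : ℂ)⁻¹ := by
  rw [← Complex.ofReal_natCast, ← Complex.ofReal_inv]
  exact Complex.zero_le_real.mpr (by positivity)

theorem idealState_nonneg {ρ : Matrix (Z × E) (Z × E) ℂ} (h : 0 ≤ ρ) : 0 ≤ idealState S ρ :=
  cqMatrix_nonneg fun _ => smul_nonneg_matrix (marginalRight_nonneg h) (inv_natCast_nonneg _)

theorem trace_keyState (f : Z → S) (ρ : Matrix (Z × E) (Z × E) ℂ) :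
    (keyState f ρ).trace = ρ.trace := by
  rw [keyState, trace_cqMatrix, ← trace_sum, sum_keyBlock, trace_marginalRight]

theorem trace_idealState [Nonempty S] (ρ : Matrix (Z × E) (Z × E) ℂ) :
    (idealState S ρ).trace = ρ.trace := by
  rw [idealState, trace_cqMatrix]
  simp [trace_marginalRight]

theorem seedBlock_mono {M N : Matrix (S × (E × F)) (S × (E × F)) ℂ} (h : M ≤ N) (f : F) :
    seedBlock M f ≤ seedBlock N f :=
  le_iff.mpr ((le_iff.mp h).submatrix (fun x : S × E => (x.1, (x.2, f))))

theorem seedBlock_one [DecidableEq F] (f : F) :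
    seedBlock (1 : Matrix (S × (E × F)) (S × (E × F)) ℂ) f = 1 :=
  submatrix_one _ fun x y h => by
    simp only [Prod.mk.injEq, and_true] at h
    exact Prod.ext h.1 h.2

/-- The operator which measures `M f` if the seed is `f`. -/
def seedDiagonal [Fintype F] [DecidableEq F] (M : F → Matrix (S × E) (S × E) ℂ) :
    Matrix (S × (E × F)) (S × (E × F)) ℂ :=
  (cqMatrix M).submatrix (fun x => (x.2.2, (x.1, x.2.1))) (fun x => (x.2.2, (x.1, x.2.1)))

theorem seedBlock_seedDiagonal [Fintype F] [DecidableEq F] (M : F → Matrix (S × E) (S × E) ℂ)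
    (f : F) : seedBlock (seedDiagonal M) f = M f := by
  ext x y
  simp [seedBlock, seedDiagonal, cqMatrix]

theorem seedDiagonal_mono [Fintype F] [DecidableEq F] {M N : F → Matrix (S × E) (S × E) ℂ}
    (h : ∀ f, M f ≤ N f) : seedDiagonal M ≤ seedDiagonal N :=
  le_iff.mpr ((le_iff.mp (cqMatrix_mono h)).submatrix _)

theorem seedDiagonal_zero [Fintype F] [DecidableEq F] :
    seedDiagonal (0 : F → Matrix (S × E) (S × E) ℂ) = 0 := by
  ext x y
  simp [seedDiagonal, cqMatrix]

theorem seedDiagonal_one [Fintype F] [DecidableEq F] :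
    seedDiagonal (fun _ : F => (1 : Matrix (S × E) (S × E) ℂ)) = 1 := by
  rw [seedDiagonal, cqMatrix_one]
  refine submatrix_one _ fun x y h => ?_
  simp only [Prod.mk.injEq] at h
  exact Prod.ext h.2.1 (Prod.ext h.2.2 h.1)

section DualNorm

variable {n : Type*} [Fintype n] [DecidableEq n]

theorem trace_mul_im_eq_zero {A B : Matrix n n ℂ} (hA : Aᴴ = A) (hB : Bᴴ = B) :
    (A * B).trace.im = 0 := by
  have h := trace_conjTranspose (A * B)
  rw [conjTranspose_mul, hA, hB, trace_mul_comm] at h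
  exact Complex.conj_eq_iff_im.mp h.symm

theorem dualNorm_le {ξ : Matrix n n ℂ} (hξ : ξᴴ = ξ) {c : ℝ}
    (h : ∀ M : Matrix n n ℂ, 0 ≤ M → M ≤ 1 → |(ξ * M).trace.re| ≤ c) : dualNorm ξ ≤ c := by
  refine csSup_le ⟨_, 0, le_rfl, zero_le_one, rfl⟩ ?_
  rintro _ ⟨M, hM, hM1, rfl⟩
  rw [← Complex.abs_re_eq_norm.mpr (trace_mul_im_eq_zero hξ hM.isSelfAdjoint)]
  exact h M hM hM1

theorem conj_nonneg {A : Matrix n n ℂ} (h : 0 ≤ A) (X : Matrix n n ℂ) : 0 ≤ X * A * Xᴴ := by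
  simpa using conj_mono h X

theorem mul_self_le_self {M : Matrix n n ℂ} (hM : 0 ≤ M) (hM1 : M ≤ 1) : M * M ≤ M := by
  have hM2 : 0 ≤ 1 - M := sub_nonneg.mpr hM1
  -- The two conjugations add up: `M (1 - M) M + (1 - M) M (1 - M) = M - M * M`.
  have h := add_nonneg (conj_nonneg hM2 M) (conj_nonneg hM (1 - M))
  have e1 : Mᴴ = M := hM.isSelfAdjoint
  have e2 : (1 - M)ᴴ = 1 - M := hM2.isSelfAdjoint
  rw [e1, e2] at h
  rw [← sub_nonneg]
  refine h.trans_eq ?_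
  noncomm_ring

theorem norm_apply_le_one {M : Matrix n n ℂ} (hM : 0 ≤ M) (hM1 : M ≤ 1) (i j : n) :
    ‖M i j‖ ≤ 1 := by
  have h := (le_iff.mp ((mul_self_le_self hM hM1).trans hM1)).diag_nonneg (i := i)
  have hs (j : n) : M j i = star (M i j) := by
    rw [← conjTranspose_apply, show Mᴴ = M from hM.isSelfAdjoint]
  have h2 : ∑ j, ‖M i j‖ ^ 2 ≤ 1 := by
    have := (Complex.le_def.mp h).1
    rw [Matrix.sub_apply, one_apply_eq, mul_apply, Complex.sub_re, Complex.re_sum] at this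
    simp only [hs, Complex.star_def, Complex.mul_conj, Complex.ofReal_re,
      Complex.normSq_eq_norm_sq] at this
    simpa using this
  have h3 := (Finset.single_le_sum (f := fun j => ‖M i j‖ ^ 2) (fun j _ => sq_nonneg _)
    (Finset.mem_univ j)).trans h2
  exact (sq_le_one_iff₀ (norm_nonneg _)).mp h3

theorem trace_re_le_dualNorm (ξ : Matrix n n ℂ) {M : Matrix n n ℂ} (hM : 0 ≤ M) (hM1 : M ≤ 1) :
    (ξ * M).trace.re ≤ dualNorm ξ := by
  refine (Complex.re_le_norm _).trans (le_csSup ?_ ⟨M, hM, hM1, rfl⟩)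
  -- Entries of an effect have modulus at most one. The bound is needed because a real `sSup` of an
  -- unbounded set would be `0`.
  refine ⟨∑ i, ∑ j, ‖ξ i j‖ * 1, ?_⟩
  rintro _ ⟨M, hM, hM1, rfl⟩
  refine (norm_sum_le _ _).trans (Finset.sum_le_sum fun i _ => ?_)
  rw [diag_apply, mul_apply]
  refine (norm_sum_le _ _).trans (Finset.sum_le_sum fun j _ => ?_)
  rw [norm_mul]
  gcongr
  exact norm_apply_le_one hM hM1 j i

end DualNorm

/-- Together with `le_secrecyDist` this reduces secrecy to tests chosen separately for each seed,
averaged over the seed. -/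
theorem ExtractionProtocol.secrecyDist_le {ρ : Matrix (Z × E) (Z × E) ℂ} (hρ : 0 ≤ ρ) {c : ℝ}
    (h : ∀ M : P.family → Matrix (S × E) (S × E) ℂ, (∀ f, 0 ≤ M f) → (∀ f, M f ≤ 1) →
      |∑ f, P.prob f * ((keyState f.1 ρ - idealState S ρ) * M f).trace.re| ≤ c) :
    secrecyDist (P.output ρ) ≤ c := by
  refine dualNorm_le ?_ fun M hM hM1 => ?_
  · ext x y
    rw [conjTranspose_apply, P.output_sub_apply, P.output_sub_apply]
    by_cases hxy : x.2.2 = y.2.2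
    · rw [if_pos hxy, if_pos hxy.symm]
      have hs : (keyState x.2.2.1 ρ - idealState S ρ)ᴴ = keyState x.2.2.1 ρ - idealState S ρ := by
        rw [conjTranspose_sub, (nonneg_iff_posSemidef.mp (keyState_nonneg _ hρ)).isHermitian.eq,
          (nonneg_iff_posSemidef.mp (idealState_nonneg hρ)).isHermitian.eq]
      rw [star_mul', ← conjTranspose_apply, ← hxy, hs, Complex.star_def, Complex.conj_ofReal]
    · rw [if_neg hxy, if_neg (Ne.symm hxy), star_zero]
  · have := h (seedBlock M) (fun f => seedBlock_mono hM f)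
      (fun f => (seedBlock_mono hM1 f).trans_eq (seedBlock_one f))
    rw [P.trace_output_sub_mul, Complex.re_sum]
    simpa only [Complex.re_ofReal_mul] using this

theorem ExtractionProtocol.le_secrecyDist (ρ : Matrix (Z × E) (Z × E) ℂ)
    {M : P.family → Matrix (S × E) (S × E) ℂ} (hM : ∀ f, 0 ≤ M f) (hM1 : ∀ f, M f ≤ 1) :
    ∑ f, P.prob f * ((keyState f.1 ρ - idealState S ρ) * M f).trace.re ≤
      secrecyDist (P.output ρ) := by
  obtain ⟨N, h0, h1, hN⟩ : ∃ N : Matrix (S × (E × P.family)) (S × (E × P.family)) ℂ,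
      0 ≤ N ∧ N ≤ 1 ∧ ∀ f, seedBlock N f = M f :=
    ⟨seedDiagonal M, seedDiagonal_zero.symm.trans_le (seedDiagonal_mono hM),
      (seedDiagonal_mono hM1).trans_eq seedDiagonal_one, seedBlock_seedDiagonal M⟩
  rw [secrecyDist, traceDist]
  refine le_of_eq_of_le ?_ (trace_re_le_dualNorm _ h0 h1)
  rw [P.trace_output_sub_mul, Complex.re_sum]
  simp only [Complex.re_ofReal_mul, hN]

end QInfo

/-! ### Leftover hashing with a uniformly random function -/

namespace QInfo

open Matrix

section Quadratic

variable {n : Type*} [Fintype n] [DecidableEq n]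

/-- Completing the square: expand `0 ≤ tr (Xᴴ σ X)` for `X = σ⁻¹ ξ - c N` and divide by `c`. -/
theorem two_mul_trace_mul_re_le {σ ξ N : Matrix n n ℂ} (hσ : σ.PosDef) (hξ : ξᴴ = ξ) (hN : Nᴴ = N)
    {c : ℝ} (hc : 0 < c) :
    2 * (ξ * N).trace.re ≤ c⁻¹ * (ξ * σ⁻¹ * ξ).trace.re + c * (N * σ * N).trace.re := by
  have hu : IsUnit σ.det := (Matrix.isUnit_iff_isUnit_det σ).mp hσ.isUnit
  have hi : (σ⁻¹)ᴴ = σ⁻¹ := hσ.inv.isHermitian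
  have h := (hσ.posSemidef.conjTranspose_mul_mul_same (σ⁻¹ * ξ - (c : ℂ) • N)).trace_nonneg
  have e : (σ⁻¹ * ξ - (c : ℂ) • N)ᴴ * σ * (σ⁻¹ * ξ - (c : ℂ) • N) =
      ξ * σ⁻¹ * ξ - (c : ℂ) • (ξ * N) - (c : ℂ) • (N * ξ) + ((c : ℂ) * c) • (N * σ * N) := by
    rw [conjTranspose_sub, conjTranspose_mul, conjTranspose_smul, hξ, hi, hN, Complex.star_def,
      Complex.conj_ofReal, Matrix.sub_mul, Matrix.sub_mul, Matrix.mul_sub, Matrix.mul_sub]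
    simp only [Matrix.smul_mul, Matrix.mul_smul, Matrix.mul_assoc,
      Matrix.nonsing_inv_mul_cancel_left σ _ hu, Matrix.mul_nonsing_inv_cancel_left σ _ hu,
      smul_smul]
    abel
  have h' := (Complex.le_def.mp h).1
  rw [e, trace_add, trace_sub, trace_sub, trace_smul, trace_smul, trace_smul, trace_mul_comm N ξ]
    at h'
  simp only [Complex.zero_re, smul_eq_mul, ← Complex.ofReal_mul, Complex.add_re, Complex.sub_re,
    Complex.re_ofReal_mul] at h'
  have h2 := mul_le_mul_of_nonneg_left h' (inv_pos.mpr hc).le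
  have h3 : c⁻¹ * c = 1 := inv_mul_cancel₀ hc.ne'
  linear_combination h2 - (2 * (ξ * N).trace.re - c * (N * σ * N).trace.re) * h3

/-- The effect is centered at `1 / 2` because `(M - 1/2)² ≤ 1/4`, a better constant than `M² ≤ 1`.
The term `tr ξ` so created cancels after summation over the key. -/
theorem two_mul_trace_effect_re_le {σ ξ M : Matrix n n ℂ} (hσ : σ.PosDef) (hξ : ξᴴ = ξ)
    (hM : 0 ≤ M) (hM1 : M ≤ 1) {c : ℝ} (hc : 0 < c) :
    2 * (ξ * M).trace.re - ξ.trace.re ≤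
      c⁻¹ * (ξ * σ⁻¹ * ξ).trace.re + c / 4 * σ.trace.re := by
  have hMh : Mᴴ = M := hM.isSelfAdjoint
  have hN : (M - (1 / 2 : ℂ) • (1 : Matrix n n ℂ))ᴴ = M - (1 / 2 : ℂ) • 1 := by
    rw [conjTranspose_sub, hMh, conjTranspose_smul, conjTranspose_one]; simp
  have h := two_mul_trace_mul_re_le hσ hξ hN hc
  have h1 : (ξ * (M - (1 / 2 : ℂ) • (1 : Matrix n n ℂ))).trace.re =
      (ξ * M).trace.re - 1 / 2 * ξ.trace.re := by
    rw [Matrix.mul_sub, Matrix.mul_smul, Matrix.mul_one, trace_sub, trace_smul, smul_eq_mul,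
      Complex.sub_re, show (1 / 2 : ℂ) = ((1 / 2 : ℝ) : ℂ) by norm_num, Complex.re_ofReal_mul]
  have h2 : ((M - (1 / 2 : ℂ) • (1 : Matrix n n ℂ)) * σ *
      (M - (1 / 2 : ℂ) • (1 : Matrix n n ℂ))).trace.re ≤ 1 / 4 * σ.trace.re := by
    have e : (M - (1 / 2 : ℂ) • (1 : Matrix n n ℂ)) * (M - (1 / 2 : ℂ) • (1 : Matrix n n ℂ)) =
        M * M - M + ((1 / 4 : ℝ) : ℂ) • (1 : Matrix n n ℂ) := by
      rw [Matrix.sub_mul, Matrix.mul_sub, Matrix.mul_sub]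
      simp only [Matrix.smul_mul, Matrix.mul_smul, Matrix.mul_one, Matrix.one_mul, smul_smul]
      module
    rw [trace_mul_comm, ← Matrix.mul_assoc, e, Matrix.add_mul, trace_add, Matrix.smul_mul,
      Matrix.one_mul, trace_smul, smul_eq_mul, Complex.add_re, Complex.re_ofReal_mul,
      Matrix.sub_mul, trace_sub, Complex.sub_re]
    have := trace_mul_re_mono (mul_self_le_self hM hM1) (nonneg_iff_posSemidef.mpr hσ.posSemidef)
    linarith
  rw [h1] at h
  have h3 := mul_le_mul_of_nonneg_left h2 hc.le
  linarith

theorem trace_mul_inv_mul_re_nonneg {σ r : Matrix n n ℂ} (hσ : σ.PosDef) (hr : rᴴ = r) :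
    0 ≤ (r * σ⁻¹ * r).trace.re := by
  have := (hσ.inv.posSemidef.conjTranspose_mul_mul_same r).trace_nonneg
  rw [hr] at this
  exact (Complex.le_def.mp this).1

/-- With `X = c - σ⁻¹ r`, expand `0 ≤ tr (Xᴴ r X)` and bound its last term `tr (r σ⁻¹ r σ⁻¹ r)` by
`c tr (r σ⁻¹ r)`, using `r ≤ c σ` in the middle. -/
theorem trace_mul_inv_mul_re_le {σ r : Matrix n n ℂ} (hσ : σ.PosDef) (hr : 0 ≤ r) {c : ℝ}
    (hc : 0 < c) (hle : r ≤ (c : ℂ) • σ) : (r * σ⁻¹ * r).trace.re ≤ c * r.trace.re := by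
  have hu : IsUnit σ.det := (Matrix.isUnit_iff_isUnit_det σ).mp hσ.isUnit
  have hi : (σ⁻¹)ᴴ = σ⁻¹ := hσ.inv.isHermitian
  have hrh : rᴴ = r := hr.isSelfAdjoint
  have h := ((nonneg_iff_posSemidef.mp hr).conjTranspose_mul_mul_same
    ((c : ℂ) • (1 : Matrix n n ℂ) - σ⁻¹ * r)).trace_nonneg
  have e : ((c : ℂ) • (1 : Matrix n n ℂ) - σ⁻¹ * r)ᴴ * r * ((c : ℂ) • (1 : Matrix n n ℂ) - σ⁻¹ * r) =
      ((c : ℂ) * c) • r - (c : ℂ) • (r * σ⁻¹ * r) - (c : ℂ) • (r * σ⁻¹ * r) +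
        r * σ⁻¹ * r * (r * σ⁻¹)ᴴ := by
    rw [conjTranspose_sub, conjTranspose_mul, conjTranspose_mul, conjTranspose_smul, hrh, hi,
      Complex.star_def, Complex.conj_ofReal, conjTranspose_one, Matrix.sub_mul, Matrix.sub_mul,
      Matrix.mul_sub, Matrix.mul_sub]
    simp only [Matrix.smul_mul, Matrix.mul_smul, Matrix.mul_assoc, Matrix.mul_one, Matrix.one_mul,
      smul_smul]
    abel
  have e2 : r * σ⁻¹ * ((c : ℂ) • σ) * (r * σ⁻¹)ᴴ = (c : ℂ) • (r * σ⁻¹ * r) := by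
    rw [conjTranspose_mul, hrh, hi]
    simp only [Matrix.smul_mul, Matrix.mul_smul, Matrix.mul_assoc,
      Matrix.mul_nonsing_inv_cancel_left σ _ hu]
  have h1 := trace_re_mono (conj_mono hle (r * σ⁻¹))
  have h' := (Complex.le_def.mp h).1
  rw [e2] at h1
  rw [e, trace_add, trace_sub, trace_sub] at h'
  simp only [Complex.zero_re, trace_smul, smul_eq_mul, ← Complex.ofReal_mul, Complex.add_re,
    Complex.sub_re, Complex.re_ofReal_mul] at h' h1
  have h2 : c * (r * σ⁻¹ * r).trace.re ≤ c * (c * r.trace.re) := by linarith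
  exact le_of_mul_le_mul_left h2 hc

end Quadratic

variable {Z S E : Type*} [Fintype Z] [DecidableEq Z] [Fintype S] [DecidableEq S] [Fintype E]
  [DecidableEq E]

/-- The values of a uniformly random function at distinct points are independent: splitting off the
value at `z` factorizes the sum. -/
theorem sum_mul_apply_eq_zero {u : S → ℂ} (hu : ∑ a, u a = 0) {z z' : Z} (h : z ≠ z') :
    ∑ f : Z → S, u (f z) * u (f z') = 0 := by
  rw [Fintype.sum_equiv (Equiv.funSplitAt z S) (fun f => u (f z) * u (f z'))
    (fun p => u p.1 * u (p.2 ⟨z', h.symm⟩)) (fun f => rfl), Fintype.sum_prod_type]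
  simp_rw [← Finset.mul_sum, ← Finset.sum_mul, hu, zero_mul]

/-- The indicator function of a key, centered. -/
noncomputable def centered (s a : S) : ℂ := (if a = s then 1 else 0) - (Fintype.card S : ℂ)⁻¹

theorem sum_centered [Nonempty S] (s : S) : ∑ a, centered s a = 0 := by
  simp [centered]

theorem sum_centered_sq [Nonempty S] (a : S) :
    ∑ s, centered s a * centered s a = ((1 - (Fintype.card S : ℝ)⁻¹ : ℝ) : ℂ) := by
  have h : (Fintype.card S : ℂ) ≠ 0 := by simp
  have (s : S) : centered s a * centered s a =
      (if a = s then 1 - 2 * (Fintype.card S : ℂ)⁻¹ else 0) +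
        (Fintype.card S : ℂ)⁻¹ * (Fintype.card S : ℂ)⁻¹ := by
    simp only [centered]; split_ifs <;> ring
  simp only [this, Finset.sum_add_distrib, Finset.sum_ite_eq, Finset.mem_univ, if_true,
    Finset.sum_const, Finset.card_univ, nsmul_eq_mul]
  push_cast
  field_simp
  ring

theorem keyBlock_sub_eq (f : Z → S) (τ : Matrix (Z × E) (Z × E) ℂ) (s : S) :
    keyBlock f τ s - (Fintype.card S : ℂ)⁻¹ • marginalRight τ =
      ∑ z, centered s (f z) • cqBlock τ z := by
  rw [keyBlock, marginalRight_eq_sum, Finset.smul_sum, ← Finset.sum_sub_distrib]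
  refine Finset.sum_congr rfl fun z _ => ?_
  rw [centered, sub_smul, ite_smul, one_smul, zero_smul]

/-- The second-moment computation of leftover hashing: independence kills the pairs `z ≠ z'`, and
each diagonal term carries the factor `1 - 1/|S|` from `sum_centered_sq`. -/
theorem sum_quadratic [Nonempty S] (R : Matrix E E ℂ) (r : Z → Matrix E E ℂ) :
    ∑ f : Z → S, ∑ s, ((∑ z, centered s (f z) • r z) * R *
        (∑ z, centered s (f z) • r z)).trace =
      (Fintype.card (Z → S) : ℂ) * ((1 - (Fintype.card S : ℝ)⁻¹ : ℝ) : ℂ) *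
        ∑ z, (r z * R * r z).trace := by
  have expand (f : Z → S) (s : S) : ((∑ z, centered s (f z) • r z) * R *
        (∑ z, centered s (f z) • r z)).trace =
      ∑ z, ∑ z', centered s (f z) * centered s (f z') * (r z * R * r z').trace := by
    simp only [Matrix.sum_mul, Matrix.mul_sum, trace_sum, Matrix.smul_mul, Matrix.mul_smul,
      trace_smul, smul_eq_mul, mul_assoc]
    rw [Finset.sum_comm]
    refine Finset.sum_congr rfl fun z _ => ?_
    rw [Finset.mul_sum]
    refine Finset.sum_congr rfl fun z' _ => ?_
    ring
  simp only [expand]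
  have swap : ∑ f : Z → S, ∑ s, ∑ z, ∑ z', centered s (f z) * centered s (f z') *
        (r z * R * r z').trace =
      ∑ z, ∑ z', (∑ s, ∑ f : Z → S, centered s (f z) * centered s (f z')) *
        (r z * R * r z').trace := by
    simp only [Finset.sum_mul]
    rw [Finset.sum_comm]
    simp only [Finset.sum_comm (s := (Finset.univ : Finset (Z → S)))]
    rw [Finset.sum_comm]
    refine Finset.sum_congr rfl fun z _ => ?_
    rw [Finset.sum_comm]
  rw [swap, Finset.mul_sum]
  refine Finset.sum_congr rfl fun z _ => ?_
  rw [Finset.sum_eq_single z]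
  · rw [Finset.sum_comm]
    simp only [sum_centered_sq, Finset.sum_const, Finset.card_univ, nsmul_eq_mul]
  · intro z' _ hz
    rw [Finset.sum_eq_zero fun s _ => sum_mul_apply_eq_zero (sum_centered s) hz.symm, zero_mul]
  · simp

theorem trace_keyState_sub_mul (f : Z → S) (τ : Matrix (Z × E) (Z × E) ℂ)
    (M : Matrix (S × E) (S × E) ℂ) :
    ((keyState f τ - idealState S τ) * M).trace =
      ∑ s, ((∑ z, centered s (f z) • cqBlock τ z) * cqBlock M s).trace := by
  rw [keyState, idealState, ← cqMatrix_sub, trace_cqMatrix_mul]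
  simp only [keyBlock_sub_eq]

theorem sum_trace_keyState_sub_mul_le [Nonempty S] {τ : Matrix (Z × E) (Z × E) ℂ} (hτ : 0 ≤ τ)
    (hτ1 : τ.trace.re ≤ 1) {σ : Matrix E E ℂ} (hσ : σ.PosDef) (hσ2 : σ.trace.re ≤ 2) {c δ : ℝ}
    (hc : 0 < c) (hδ : 0 < δ) (hle : ∀ z, cqBlock τ z ≤ (c : ℂ) • σ)
    (hcδ : c * Fintype.card S ≤ 2 * δ ^ 2) {M : (Z → S) → Matrix (S × E) (S × E) ℂ}
    (hM : ∀ f, 0 ≤ M f) (hM1 : ∀ f, M f ≤ 1) :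
    ∑ f, ((keyState f τ - idealState S τ) * M f).trace.re ≤ Fintype.card (Z → S) * δ := by
  set ℓ : ℝ := (Fintype.card S : ℝ) with hℓ
  set N : ℝ := (Fintype.card (Z → S) : ℝ) with hN
  have hℓ0 : 0 < ℓ := by rw [hℓ]; exact_mod_cast Fintype.card_pos
  have hN0 : 0 < N := by rw [hN]; exact_mod_cast Fintype.card_pos
  -- This weight balances the two error terms: summed over `s`, the `σ` term is `|S| (k / 4) tr σ ≤
  -- δ`, and `k⁻¹ c = c |S| / (2 δ) ≤ δ`.
  set k : ℝ := 2 * δ / ℓ with hk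
  have hk0 : 0 < k := by positivity
  let ξ (f : Z → S) (s : S) : Matrix E E ℂ := ∑ z, centered s (f z) • cqBlock τ z
  have hcent (s a : S) : star (centered s a) = centered s a := by
    simp only [centered]; split_ifs <;> simp
  have hblock (z : Z) : (cqBlock τ z)ᴴ = cqBlock τ z := (cqBlock_nonneg hτ z).isSelfAdjoint
  have hξ (f : Z → S) (s : S) : (ξ f s)ᴴ = ξ f s := by
    simp only [ξ, conjTranspose_sum, conjTranspose_smul, hcent, hblock]
  have h0 (f : Z → S) : ∑ s, (ξ f s).trace.re = 0 := by
    have := trace_keyState_sub_mul f τ (1 : Matrix (S × E) (S × E) ℂ)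
    simp only [cqBlock_one, Matrix.mul_one, trace_sub, trace_keyState, trace_idealState,
      sub_self] at this
    rw [← Complex.re_sum, ← this, Complex.zero_re]
  have h1 (f : Z → S) : 2 * ((keyState f τ - idealState S τ) * M f).trace.re ≤
      k⁻¹ * ∑ s, (ξ f s * σ⁻¹ * ξ f s).trace.re + δ := by
    have h2 := Finset.sum_le_sum fun s (_ : s ∈ Finset.univ) =>
      two_mul_trace_effect_re_le hσ (hξ f s) (cqBlock_nonneg (hM f) s)
        (cqBlock_le_one (hM1 f) s) hk0
    rw [Finset.sum_sub_distrib, h0, sub_zero, ← Finset.mul_sum, Finset.sum_add_distrib,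
      ← Finset.mul_sum, Finset.sum_const, Finset.card_univ, nsmul_eq_mul, ← hℓ] at h2
    rw [trace_keyState_sub_mul, Complex.re_sum]
    refine h2.trans (add_le_add_right ?_ _)
    have : ℓ * (k / 4 * σ.trace.re) = δ / 2 * σ.trace.re := by rw [hk]; field_simp; ring
    rw [this]
    nlinarith
  have h3 := Finset.sum_le_sum fun f (_ : f ∈ Finset.univ) => h1 f
  rw [← Finset.mul_sum, Finset.sum_add_distrib, ← Finset.mul_sum, Finset.sum_const,
    Finset.card_univ, nsmul_eq_mul, ← hN] at h3
  have h4 := congrArg Complex.re (sum_quadratic (S := S) σ⁻¹ (cqBlock τ))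
  simp only [Complex.re_sum] at h4
  rw [← Complex.ofReal_natCast, ← Complex.ofReal_mul, Complex.re_ofReal_mul, Complex.re_sum,
    ← hN, ← hℓ] at h4
  have h5 : ∑ z, (cqBlock τ z * σ⁻¹ * cqBlock τ z).trace.re ≤ c := by
    refine (Finset.sum_le_sum fun z _ =>
      trace_mul_inv_mul_re_le hσ (cqBlock_nonneg hτ z) hc (hle z)).trans ?_
    rw [← Finset.mul_sum, ← Complex.re_sum, sum_trace_cqBlock]
    exact mul_le_of_le_one_right hc.le hτ1
  have h6 : 0 ≤ ∑ z, (cqBlock τ z * σ⁻¹ * cqBlock τ z).trace.re :=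
    Finset.sum_nonneg fun z _ => trace_mul_inv_mul_re_nonneg hσ (hblock z)
  have h7 : N * (1 - ℓ⁻¹) * ∑ z, (cqBlock τ z * σ⁻¹ * cqBlock τ z).trace.re ≤ N * c := by
    rw [mul_assoc]
    refine mul_le_mul_of_nonneg_left (le_trans ?_ h5) hN0.le
    have : 0 < ℓ⁻¹ := inv_pos.mpr hℓ0
    exact mul_le_of_le_one_left h6 (by linarith)
  have h8 : k⁻¹ * (N * c) ≤ N * δ := by
    have : k⁻¹ * (N * c) = N * (c * ℓ) / (2 * δ) := by rw [hk]; field_simp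
    rw [this, div_le_iff₀ (by positivity)]
    nlinarith
  have h9 := mul_le_mul_of_nonneg_left (h4.trans_le h7) (inv_pos.mpr hk0).le
  change _ ≤ k⁻¹ * ∑ f : Z → S, ∑ s, _ + _ at h3
  linarith

theorem abs_sum_trace_keyState_sub_mul_le [Nonempty S] {τ : Matrix (Z × E) (Z × E) ℂ} (hτ : 0 ≤ τ)
    (hτ1 : τ.trace.re ≤ 1) {σ : Matrix E E ℂ} (hσ : σ.PosDef) (hσ2 : σ.trace.re ≤ 2) {c δ : ℝ}
    (hc : 0 < c) (hδ : 0 < δ) (hle : ∀ z, cqBlock τ z ≤ (c : ℂ) • σ)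
    (hcδ : c * Fintype.card S ≤ 2 * δ ^ 2) {M : (Z → S) → Matrix (S × E) (S × E) ℂ}
    (hM : ∀ f, 0 ≤ M f) (hM1 : ∀ f, M f ≤ 1) :
    |∑ f, ((keyState f τ - idealState S τ) * M f).trace.re| ≤ Fintype.card (Z → S) * δ := by
  refine abs_le.mpr ⟨?_, sum_trace_keyState_sub_mul_le hτ hτ1 hσ hσ2 hc hδ hle hcδ hM hM1⟩
  -- The complementary effects `1 - M f` give the lower bound, as the real and ideal states have
  -- equal trace.
  have h := sum_trace_keyState_sub_mul_le hτ hτ1 hσ hσ2 hc hδ hle hcδ (M := fun f => 1 - M f)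
    (fun f => sub_nonneg.mpr (hM1 f)) (fun f => sub_le_self _ (hM f))
  simp only [Matrix.mul_sub, Matrix.mul_one, trace_sub, trace_keyState, trace_idealState,
    sub_self, zero_sub, Complex.neg_re, Finset.sum_neg_distrib] at h
  linarith

/-- Heisenberg picture: a test on the key is pulled back to a test on `ZE`, so that states on `ZE`
can be compared directly. `trace_idealState_mul` does the same for the ideal key. -/
theorem trace_keyState_mul (f : Z → S) (X : Matrix (Z × E) (Z × E) ℂ)
    (M : Matrix (S × E) (S × E) ℂ) :
    (keyState f X * M).trace = (X * cqMatrix fun z => cqBlock M (f z)).trace := by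
  rw [keyState, trace_cqMatrix_mul, trace_mul_cqMatrix]
  simp only [keyBlock, Matrix.sum_mul, trace_sum]
  rw [Finset.sum_comm]
  refine Finset.sum_congr rfl fun z _ => ?_
  rw [Finset.sum_eq_single (f z) (fun s _ hs => by rw [if_neg hs.symm]; simp) (by simp),
    if_pos rfl]

theorem trace_idealState_mul (X : Matrix (Z × E) (Z × E) ℂ) (M : Matrix (S × E) (S × E) ℂ) :
    (idealState S X * M).trace =
      (X * cqMatrix fun _ => (Fintype.card S : ℂ)⁻¹ • ∑ s, cqBlock M s).trace := by
  rw [idealState, trace_cqMatrix_mul, trace_mul_cqMatrix, marginalRight_eq_sum]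
  simp only [Matrix.smul_mul, Matrix.mul_smul, Matrix.sum_mul, Matrix.mul_sum, trace_smul,
    trace_sum, ← Finset.smul_sum]
  rw [Finset.sum_comm]

theorem keyState_sub (f : Z → S) (X Y : Matrix (Z × E) (Z × E) ℂ) :
    keyState f (X - Y) = keyState f X - keyState f Y := by
  rw [keyState, keyState, keyState, ← cqMatrix_sub]
  congr 1
  ext s e e'
  simp only [Matrix.sub_apply, keyBlock_apply, ← Finset.sum_sub_distrib]
  refine Finset.sum_congr rfl fun z _ => ?_
  split_ifs <;> simp

theorem idealState_sub (X Y : Matrix (Z × E) (Z × E) ℂ) :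
    idealState S (X - Y) = idealState S X - idealState S Y := by
  rw [idealState, idealState, idealState, ← cqMatrix_sub]
  congr 1
  ext s e e'
  simp [marginalRight, mul_sub]

/-- Both pullbacks of an effect are effects on `ZE`, and each contributes the purified distance
once. -/
theorem abs_trace_keyState_sub_le [Nonempty S] {ρ τ : Matrix (Z × E) (Z × E) ℂ}
    (hρ : IsSubnormalized ρ) (hτ : IsSubnormalized τ) (f : Z → S) {M : Matrix (S × E) (S × E) ℂ}
    (hM : 0 ≤ M) (hM1 : M ≤ 1) :
    |((keyState f τ - idealState S τ) * M).trace.re -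
      ((keyState f ρ - idealState S ρ) * M).trace.re| ≤ 2 * purifiedDist τ ρ := by
  have hcard : (Fintype.card S : ℂ) ≠ 0 := by simp
  have e : ((keyState f τ - idealState S τ) * M).trace.re -
      ((keyState f ρ - idealState S ρ) * M).trace.re =
      ((τ - ρ) * cqMatrix fun z => cqBlock M (f z)).trace.re -
      ((τ - ρ) * cqMatrix fun _ => (Fintype.card S : ℂ)⁻¹ • ∑ s, cqBlock M s).trace.re := by
    rw [← trace_keyState_mul, ← trace_idealState_mul, keyState_sub, idealState_sub]
    simp only [Matrix.sub_mul, trace_sub, Complex.sub_re]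
    ring
  have h1 := abs_trace_sub_le_purifiedDist hτ hρ
    (cqMatrix_nonneg fun z => cqBlock_nonneg hM (f z))
    ((cqMatrix_mono fun z => cqBlock_le_one hM1 (f z)).trans_eq cqMatrix_one)
  have h2 := abs_trace_sub_le_purifiedDist hτ hρ (M := cqMatrix fun _ =>
      (Fintype.card S : ℂ)⁻¹ • ∑ s, cqBlock M s)
    (cqMatrix_nonneg fun _ => smul_nonneg_matrix
      (Finset.sum_nonneg fun s _ => cqBlock_nonneg hM s) (inv_natCast_nonneg _))
    ((cqMatrix_mono fun _ => by
      rw [← sub_nonneg]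
      have : (1 : Matrix E E ℂ) - (Fintype.card S : ℂ)⁻¹ • ∑ s, cqBlock M s =
          (Fintype.card S : ℂ)⁻¹ • ∑ s, (1 - cqBlock M s) := by
        rw [Finset.sum_sub_distrib, smul_sub, Finset.sum_const, Finset.card_univ,
          ← Nat.cast_smul_eq_nsmul ℂ, smul_smul, inv_mul_cancel₀ hcard, one_smul]
      rw [this]
      exact smul_nonneg_matrix (Finset.sum_nonneg fun s _ =>
        sub_nonneg.mpr (cqBlock_le_one hM1 s)) (inv_natCast_nonneg _)).trans_eq cqMatrix_one)
  rw [e, two_mul]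
  exact (abs_sub _ _).trans (add_le_add h1 h2)

/-- The protocol which applies a uniformly random function. -/
noncomputable def uniformProtocol (Z S : Type*) [Fintype Z] [DecidableEq Z] [Fintype S]
    [DecidableEq S] [Nonempty S] : ExtractionProtocol Z S where
  family := Finset.univ
  prob _ := (Fintype.card (Z → S) : ℝ)⁻¹
  prob_nonneg _ := by positivity
  prob_sum := by
    rw [Finset.sum_const, Finset.card_univ, Fintype.card_coe, Finset.card_univ, nsmul_eq_mul]
    exact mul_inv_cancel₀ (by simp)

theorem secrecyDist_uniformProtocol_le [Nonempty S] {ρ τ : Matrix (Z × E) (Z × E) ℂ}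
    (hρ : IsSubnormalized ρ) (hτ : IsSubnormalized τ) {σ : Matrix E E ℂ} (hσ : σ.PosDef)
    (hσ2 : σ.trace.re ≤ 2) {c δ : ℝ} (hc : 0 < c) (hδ : 0 < δ)
    (hle : ∀ z, cqBlock τ z ≤ (c : ℂ) • σ) (hcδ : c * Fintype.card S ≤ 2 * δ ^ 2) :
    secrecyDist ((uniformProtocol Z S).output ρ) ≤ 2 * purifiedDist τ ρ + δ := by
  refine (uniformProtocol Z S).secrecyDist_le hρ.nonneg fun M hM hM1 => ?_
  set d := purifiedDist τ ρ
  have hN0 : (0 : ℝ) < Fintype.card (Z → S) := by exact_mod_cast Fintype.card_pos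
  let M' (f : Z → S) : Matrix (S × E) (S × E) ℂ := M ⟨f, Finset.mem_univ f⟩
  have e : ∑ f, (uniformProtocol Z S).prob f *
      ((keyState f.1 ρ - idealState S ρ) * M f).trace.re = (Fintype.card (Z → S) : ℝ)⁻¹ *
        ∑ f, ((keyState f ρ - idealState S ρ) * M' f).trace.re := by
    rw [Finset.mul_sum]
    exact Fintype.sum_equiv (Equiv.subtypeUnivEquiv fun f => Finset.mem_univ f) _ _ fun f => rfl
  have h1 := abs_sum_trace_keyState_sub_mul_le hτ.nonneg hτ.2 hσ hσ2 hc hδ hle hcδ (M := M')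
    (fun f => hM _) (fun f => hM1 _)
  have h2 : |∑ f, ((keyState f τ - idealState S τ) * M' f).trace.re -
      ∑ f, ((keyState f ρ - idealState S ρ) * M' f).trace.re| ≤
        Fintype.card (Z → S) * (2 * d) := by
    rw [← Finset.sum_sub_distrib]
    refine (Finset.abs_sum_le_sum_abs _ _).trans ((Finset.sum_le_sum fun f _ =>
      abs_trace_keyState_sub_le hρ hτ f (hM _) (hM1 _)).trans_eq ?_)
    rw [Finset.sum_const, Finset.card_univ, nsmul_eq_mul]
  rw [e, abs_mul, abs_of_pos (inv_pos.mpr hN0), inv_mul_le_iff₀ hN0, mul_add]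
  rw [abs_le] at *
  constructor <;> linarith

theorem isExtractable_of_le {ρ τ : Matrix (Z × E) (Z × E) ℂ} (hρ : IsSubnormalized ρ)
    (hτ : IsSubnormalized τ) {σ : Matrix E E ℂ} (hσ : IsSubnormalized σ) {c δ ε : ℝ} (hc : 0 < c)
    (hδ : 0 < δ) (hle : τ ≤ (c : ℂ) • ((1 : Matrix Z Z ℂ) ⊗ₖ σ))
    (hP : purifiedDist τ ρ ≤ (ε - δ) / 2) {ℓ : ℕ} (hℓ : 0 < ℓ) (hcδ : c * ℓ ≤ 2 * δ ^ 2) :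
    IsExtractable ε ρ ℓ := by
  have : Nonempty (Fin ℓ) := ⟨⟨0, hℓ⟩⟩
  refine ⟨hℓ, uniformProtocol Z (Fin ℓ), ?_⟩
  set d : ℝ := (Fintype.card E : ℝ) with hd
  have hd0 : 0 ≤ d := by positivity
  -- The quadratic bounds need an invertible `σ`. Adding `(d + 1)⁻¹ • 1` achieves this and raises
  -- the trace by at most one, hence the bound `2`; the `+ 1` covers `d = 0`.
  have hw : (0 : ℂ) < (((d + 1)⁻¹ : ℝ) : ℂ) := Complex.zero_lt_real.mpr (by positivity)
  have hpos : (((((d + 1)⁻¹ : ℝ) : ℂ)) • (1 : Matrix E E ℂ)).PosDef := PosDef.one.smul hw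
  have hσ' : (σ + (((d + 1)⁻¹ : ℝ) : ℂ) • (1 : Matrix E E ℂ)).PosDef :=
    PosDef.posSemidef_add hσ.1 hpos
  have htr : (σ + (((d + 1)⁻¹ : ℝ) : ℂ) • (1 : Matrix E E ℂ)).trace.re ≤ 2 := by
    rw [trace_add, trace_smul, trace_one, smul_eq_mul, Complex.add_re, Complex.re_ofReal_mul,
      Complex.natCast_re, ← hd]
    have h1 := hσ.2
    have : (d + 1)⁻¹ * d ≤ 1 := by
      rw [inv_mul_le_iff₀ (by positivity)]; linarith
    linarith
  have hle' (z : Z) : cqBlock τ z ≤ (c : ℂ) • (σ + (((d + 1)⁻¹ : ℝ) : ℂ) • (1 : Matrix E E ℂ)) := by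
    have h1 := cqBlock_mono hle z
    have h2 : cqBlock ((c : ℂ) • ((1 : Matrix Z Z ℂ) ⊗ₖ σ)) z = (c : ℂ) • σ := by
      ext e e'
      simp [cqBlock]
    rw [h2] at h1
    rw [smul_add]
    refine h1.trans (le_add_of_nonneg_right ?_)
    exact smul_nonneg_matrix (nonneg_iff_posSemidef.mpr hpos.posSemidef)
      (Complex.zero_le_real.mpr hc.le)
  have h := secrecyDist_uniformProtocol_le (S := Fin ℓ) hρ hτ hσ' htr hc hδ hle'
    (by simpa using hcδ)
  change secrecyDist _ ≤ ε
  linarith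

end QInfo

/-! ### Converse: from a secret key to a smoothed state -/

namespace QInfo

open Matrix

variable {Z S E : Type*} [Fintype Z] [DecidableEq Z] [Fintype S] [DecidableEq S] [Fintype E]
  [DecidableEq E]

theorem cqMatrix_mul (r t : Z → Matrix E E ℂ) :
    cqMatrix r * cqMatrix t = cqMatrix fun z => r z * t z := by
  ext ⟨z, e⟩ ⟨z', e'⟩
  simp only [cqMatrix, mul_apply, Matrix.of_apply, Fintype.sum_prod_type, ite_mul, zero_mul]
  rw [Finset.sum_comm]
  simp only [Finset.sum_ite_eq, Finset.mem_univ, if_true]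
  split_ifs <;> simp

theorem cqBlock_cqMatrix (r : Z → Matrix E E ℂ) (z : Z) : cqBlock (cqMatrix r) z = r z := by
  ext e e'
  simp [cqBlock, cqMatrix]

theorem conjTranspose_cqMatrix (r : Z → Matrix E E ℂ) :
    (cqMatrix r)ᴴ = cqMatrix fun z => (r z)ᴴ := by
  ext x y
  simp only [cqMatrix, conjTranspose_apply, Matrix.of_apply]
  by_cases h : x.1 = y.1
  · rw [if_pos h, if_pos h.symm, h]
  · rw [if_neg h, if_neg (Ne.symm h), star_zero]

theorem IsClassicalLeft.cqMatrix_cqBlock {ρ : Matrix (Z × E) (Z × E) ℂ} (h : IsClassicalLeft ρ) :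
    cqMatrix (cqBlock ρ) = ρ := by
  ext ⟨z, e⟩ ⟨z', e'⟩
  simp only [cqMatrix, cqBlock, Matrix.of_apply]
  split_ifs with hz
  · rw [hz]
  · exact (h z z' hz e e').symm

theorem IsClassicalLeft.sqrt_eq {ρ : Matrix (Z × E) (Z × E) ℂ} (h : IsClassicalLeft ρ)
    (hρ : 0 ≤ ρ) : CFC.sqrt ρ = cqMatrix fun z => CFC.sqrt (cqBlock ρ z) := by
  refine CFC.sqrt_unique ?_ (cqMatrix_nonneg fun z => CFC.sqrt_nonneg _)
  rw [cqMatrix_mul]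
  conv_rhs => rw [← h.cqMatrix_cqBlock]
  congr 1
  ext1 z
  exact CFC.sqrt_mul_sqrt_self _ (cqBlock_nonneg hρ z)

/-- The operator `∑ z, |f z⟩⟨z| ⊗ 1`. -/
def relabel (E : Type*) [DecidableEq E] (f : Z → S) : Matrix (S × E) (Z × E) ℂ :=
  Matrix.of fun x y => if x = (f y.1, y.2) then 1 else 0

/-- Classicality removes the blocks `z ≠ z'`, which conjugation would otherwise add coherently. It
makes `relabel E f * √ρ` a factor of the key state. -/
theorem relabel_mul_mul_conjTranspose (f : Z → S) {ρ : Matrix (Z × E) (Z × E) ℂ}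
    (h : IsClassicalLeft ρ) :
    relabel E f * ρ * (relabel E f)ᴴ = keyState f ρ := by
  ext ⟨s, e⟩ ⟨s', e'⟩
  rw [keyState, cqMatrix, Matrix.of_apply, keyBlock_apply, mul_apply]
  have h1 (z' : Z) (a' : E) : (relabel E f * ρ) (s, e) (z', a') =
      if f z' = s then ρ (z', e) (z', a') else 0 := by
    rw [mul_apply, Finset.sum_eq_single (z', e)]
    · simp [relabel, eq_comm (a := s)]
    · rintro ⟨z, a⟩ - hne
      rw [relabel, Matrix.of_apply]
      split_ifs with hs
      · rw [h z z' (fun hz => hne ?_), mul_zero]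
        simp only [Prod.mk.injEq] at hs
        rw [hz, hs.2]
      · rw [zero_mul]
    · simp
  simp only [Fintype.sum_prod_type, h1]
  simp only [conjTranspose_apply, relabel, Matrix.of_apply, Prod.mk.injEq]
  split_ifs with hs
  · subst hs
    refine Finset.sum_congr rfl fun z _ => ?_
    by_cases hz : f z = s
    · simp [hz]
    · simp [hz]
  · refine Finset.sum_eq_zero fun z _ => Finset.sum_eq_zero fun a _ => ?_
    by_cases hz : f z = s
    · subst hz
      simp [Ne.symm hs]
    · simp [hz]

theorem conjTranspose_relabel_mul (f : Z → S) (L : Matrix (S × E) (Z × E) ℂ) :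
    (relabel E f)ᴴ * L = L.submatrix (fun x => (f x.1, x.2)) id := by
  ext x y
  rw [mul_apply, Finset.sum_eq_single (f x.1, x.2)]
  · simp [relabel]
  · intro w _ hw
    simp [relabel, hw]
  · simp

/-- Extension of a fidelity decomposition along a function of the classical system. -/
theorem exists_extension [Nonempty S] (f : Z → S) {ρ : Matrix (Z × E) (Z × E) ℂ} (hρ : 0 ≤ ρ)
    (hcl : IsClassicalLeft ρ) :
    ∃ τ : Matrix (Z × E) (Z × E) ℂ, 0 ≤ τ ∧ τ.trace.re ≤ ρ.trace.re ∧
      τ ≤ cqMatrix (fun _ => (Fintype.card S : ℂ)⁻¹ • marginalRight ρ) ∧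
      sqrtFidelity (keyState f ρ) (idealState S ρ) ≤ sqrtFidelity τ ρ := by
  obtain ⟨L, hL, htr⟩ := exists_trace_eq_sqrtFidelity
    (relabel E f * CFC.sqrt ρ) (idealState_nonneg (S := S) hρ)
  have hK : relabel E f * CFC.sqrt ρ * (relabel E f * CFC.sqrt ρ)ᴴ =
      keyState f ρ := by
    rw [conjTranspose_mul, conjTranspose_sqrt, Matrix.mul_assoc, ← Matrix.mul_assoc (CFC.sqrt ρ),
      CFC.sqrt_mul_sqrt_self ρ hρ, ← Matrix.mul_assoc, relabel_mul_mul_conjTranspose f hcl]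
  rw [hK, conjTranspose_mul, conjTranspose_sqrt, Matrix.mul_assoc, conjTranspose_relabel_mul] at htr
  -- In each column block `z` of `L` only the row block `f z` is kept. The resulting `τ` is block
  -- diagonal, and dropping the positive terms `c s z * (c s z)ᴴ` preserves the upper bounds
  -- inherited from `L * Lᴴ`.
  let c (s : S) (z : Z) : Matrix E E ℂ := Matrix.of fun e e' => L (s, e) (z, e')
  have hc (s : S) : cqBlock (L * Lᴴ) s = ∑ z, c s z * (c s z)ᴴ := by
    ext e e'
    simp [cqBlock, mul_apply, Matrix.sum_apply, Fintype.sum_prod_type, c]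
  have hcn (s : S) (z : Z) : 0 ≤ c s z * (c s z)ᴴ :=
    nonneg_iff_posSemidef.mpr (posSemidef_self_mul_conjTranspose _)
  have hτ : cqMatrix (fun z => c (f z) z) * (cqMatrix fun z => c (f z) z)ᴴ =
      cqMatrix fun z => c (f z) z * (c (f z) z)ᴴ := by
    rw [conjTranspose_cqMatrix, cqMatrix_mul]
  refine ⟨cqMatrix fun z => c (f z) z * (c (f z) z)ᴴ, cqMatrix_nonneg fun z => hcn _ _, ?_, ?_, ?_⟩
  · have h1 := trace_re_mono hL
    rw [trace_idealState] at h1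
    refine le_trans ?_ h1
    rw [trace_cqMatrix, ← sum_trace_cqBlock, Complex.re_sum, Complex.re_sum]
    simp only [hc, trace_sum, Complex.re_sum]
    rw [Finset.sum_comm]
    exact Finset.sum_le_sum fun z _ => Finset.single_le_sum
      (f := fun s => (c s z * (c s z)ᴴ).trace.re) (fun s _ => trace_re_nonneg (hcn s z))
      (Finset.mem_univ (f z))
  · refine cqMatrix_mono fun z => ?_
    have h1 := cqBlock_mono hL (f z)
    rw [idealState, cqBlock_cqMatrix, hc] at h1
    exact (Finset.single_le_sum (f := fun z' => c (f z) z' * (c (f z) z')ᴴ)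
      (fun z' _ => hcn (f z) z') (Finset.mem_univ z)).trans h1
  -- Nothing is lost in the overlap: `√ρ` is block diagonal, so the trace reads only the kept blocks
  -- `(f z, z)`.
  · rw [← hτ, ← htr]
    refine le_of_eq_of_le ?_ (trace_sqrt_mul_le_sqrtFidelity ρ _)
    rw [trace_mul_cqMatrix, hcl.sqrt_eq hρ, trace_cqMatrix_mul]
    simp only [cqBlock_cqMatrix]
    rfl

theorem ExtractionProtocol.exists_le (P : ExtractionProtocol Z S) (v : P.family → ℝ) {c : ℝ}
    (h : ∑ f, P.prob f * v f ≤ c) : ∃ f, v f ≤ c := by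
  by_contra! hv
  have h1 : ∑ f, P.prob f * (v f - c) ≤ 0 := by
    simp only [mul_sub, Finset.sum_sub_distrib, ← Finset.sum_mul, P.prob_sum, one_mul]
    linarith
  have h2 (f : P.family) : 0 ≤ P.prob f * (v f - c) :=
    mul_nonneg (P.prob_nonneg f) (sub_nonneg.mpr (hv f).le)
  have h3 := (Finset.sum_eq_zero_iff_of_nonneg fun f _ => h2 f).mp
    (le_antisymm h1 (Finset.sum_nonneg fun f _ => h2 f))
  have h4 : ∑ f, P.prob f = 0 := Finset.sum_eq_zero fun f hf =>
    (mul_eq_zero.mp (h3 f hf)).resolve_right (sub_pos.mpr (hv f)).ne'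
  rw [P.prob_sum] at h4
  exact one_ne_zero h4

theorem ExtractionProtocol.IsSecret.exists_smoothed [Nonempty S] {P : ExtractionProtocol Z S}
    {ε : ℝ} {ρ : Matrix (Z × E) (Z × E) ℂ} (hP : P.IsSecret ε ρ) (hρ : IsSubnormalized ρ)
    (hcl : IsClassicalLeft ρ) (hε : ε ≤ 1) :
    ∃ τ : Matrix (Z × E) (Z × E) ℂ, IsSubnormalized τ ∧
      purifiedDist τ ρ ≤ √(2 * ε - ε ^ 2) ∧
      τ ≤ (Fintype.card S : ℂ)⁻¹ • ((1 : Matrix Z Z ℂ) ⊗ₖ marginalRight ρ) := by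
  choose M hM hM1 hMle using fun f : P.family => exists_trace_sub_le
    (keyState_nonneg f.1 hρ.nonneg) (idealState_nonneg (S := S) hρ.nonneg)
    ((trace_keyState f.1 ρ).trans (trace_idealState ρ).symm)
  obtain ⟨f, hf⟩ := P.exists_le _ ((P.le_secrecyDist ρ hM hM1).trans hP)
  obtain ⟨τ, hτ0, hτtr, hτle, hτF⟩ := exists_extension f.1 hρ.nonneg hcl
  have h1 := hMle f
  rw [trace_keyState] at h1
  have hρ1 := hρ.2
  refine ⟨τ, ⟨nonneg_iff_posSemidef.mp hτ0, hτtr.trans hρ.2⟩, Real.sqrt_le_sqrt ?_, ?_⟩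
  -- As `tr τ ≤ tr ρ`, the missing weights contribute at least `1 - tr ρ`, which lifts the root
  -- fidelity bound `tr ρ - ε` to `1 - ε`; and `1 - (1 - ε)² = 2ε - ε²`.
  · have h2 : 1 - ρ.trace.re ≤ √((1 - τ.trace.re) * (1 - ρ.trace.re)) := by
      refine Real.le_sqrt_of_sq_le ?_
      rw [sq]
      exact mul_le_mul_of_nonneg_right (by linarith) (by linarith)
    have h3 : (1 - ε) ^ 2 ≤ genFidelity τ ρ :=
      pow_le_pow_left₀ (by linarith) (by linarith) 2
    linarith
  · refine hτle.trans_eq ?_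
    ext x y
    simp only [cqMatrix, Matrix.of_apply, Matrix.smul_apply, kroneckerMap_apply, Matrix.one_apply]
    split_ifs <;> simp

/-- The test "the key lies in the range of `f`" always accepts the real key, but accepts the ideal
one only with a fraction at most `|Z| / |S|` of the weight. -/
theorem ExtractionProtocol.IsSecret.card_mul_le [Nonempty S] {P : ExtractionProtocol Z S}
    {ε : ℝ} {ρ : Matrix (Z × E) (Z × E) ℂ} (hP : P.IsSecret ε ρ) (hρ : 0 ≤ ρ) :
    Fintype.card S * (ρ.trace.re - ε) ≤ Fintype.card Z * ρ.trace.re := by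
  let m (f : Z → S) (s : S) : Matrix E E ℂ := if s ∈ Finset.univ.image f then 1 else 0
  have hm0 (f : Z → S) (s : S) : 0 ≤ m f s := by
    simp only [m]; split_ifs
    · exact zero_le_one
    · exact le_rfl
  have hm1 (f : Z → S) (s : S) : m f s ≤ 1 := by
    simp only [m]; split_ifs
    · exact le_rfl
    · exact zero_le_one
  obtain ⟨f, hf⟩ := P.exists_le _ ((P.le_secrecyDist ρ (M := fun f => cqMatrix (m f.1))
    (fun f => cqMatrix_nonneg (hm0 f.1))
    (fun f => (cqMatrix_mono (hm1 f.1)).trans_eq cqMatrix_one)).trans hP)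
  have h1 : (fun z => m f.1 (f.1 z)) = fun _ => 1 := by
    ext1 z
    exact if_pos (Finset.mem_image_of_mem _ (Finset.mem_univ z))
  set k : ℝ := ((Finset.univ.image f.1).card : ℝ) with hk
  have hkZ : k ≤ Fintype.card Z := by
    rw [hk]; exact_mod_cast Finset.card_image_le
  have h2 : ∑ s, m f.1 s = (k : ℂ) • (1 : Matrix E E ℂ) := by
    simp only [m]
    rw [Finset.sum_ite_mem, Finset.univ_inter, Finset.sum_const, hk, Complex.ofReal_natCast,
      Nat.cast_smul_eq_nsmul]
  have h3 : (cqMatrix fun _ : Z => (Fintype.card S : ℂ)⁻¹ • (k : ℂ) • (1 : Matrix E E ℂ)) =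
      (((Fintype.card S : ℝ)⁻¹ * k : ℝ) : ℂ) • (1 : Matrix (Z × E) (Z × E) ℂ) := by
    rw [← cqMatrix_one]
    ext x y
    simp only [cqMatrix, Matrix.of_apply, Matrix.smul_apply, smul_smul]
    split_ifs <;> simp
  rw [Matrix.sub_mul, trace_sub, trace_keyState_mul, trace_idealState_mul] at hf
  simp only [cqBlock_cqMatrix] at hf
  rw [h1, h2, h3, cqMatrix_one, Matrix.mul_one, Matrix.mul_smul, Matrix.mul_one, trace_smul,
    smul_eq_mul, Complex.sub_re, Complex.re_ofReal_mul] at hf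
  have hS : (0 : ℝ) < Fintype.card S := by exact_mod_cast Fintype.card_pos
  have h4 := mul_le_mul_of_nonneg_left hf hS.le
  have h5 : (Fintype.card S : ℝ) * ((Fintype.card S : ℝ)⁻¹ * k * ρ.trace.re) = k * ρ.trace.re := by
    field_simp
  have h6 := mul_le_mul_of_nonneg_right hkZ (trace_re_nonneg hρ)
  rw [mul_sub, h5] at h4
  linarith

end QInfo

/-! ### Entropic bounds in the extended reals -/

namespace QInfo

open Matrix

variable {Z E : Type*} [Fintype Z] [DecidableEq Z] [Fintype E] [DecidableEq E]

theorem elogb_mono {b : ℝ} (hb : 1 < b) : Monotone (elogb b) := fun _ _ h =>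
  EReal.monotone_div_right_of_nonneg (EReal.coe_nonneg.mpr (Real.log_pos hb).le)
    (ENNReal.log_monotone (ENat.toENNReal_le.mpr h))

theorem elogb_natCast (b : ℝ) {n : ℕ} (hn : 0 < n) :
    elogb b (n : ℕ∞) = ((Real.logb b n : ℝ) : EReal) := by
  rw [elogb, ENat.toENNReal_coe, ← ENNReal.ofReal_natCast,
    ENNReal.log_ofReal_of_pos (by exact_mod_cast hn), ← EReal.coe_div]
  rfl

/-- A constant key is already ideal. This keeps the set of key sizes nonempty and covers the regime
where hashing promises less than one key value. -/
theorem isExtractable_one {ρ : Matrix (Z × E) (Z × E) ℂ} (hρ : IsSubnormalized ρ) {ε : ℝ}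
    (hε : 0 ≤ ε) : IsExtractable ε ρ 1 := by
  refine ⟨one_pos, uniformProtocol Z (Fin 1), ?_⟩
  refine ExtractionProtocol.secrecyDist_le _ hρ.nonneg fun M _ _ => ?_
  have (f : Z → Fin 1) : keyState f ρ = idealState (Fin 1) ρ := by
    rw [keyState, idealState]
    congr 1
    ext s e e'
    simp [keyBlock_apply, marginalRight, Subsingleton.elim _ s]
  simpa [this] using hε

theorem le_elogb_maxKeySize {b : ℝ} (hb : 1 < b) {ε : ℝ} {ρ : Matrix (Z × E) (Z × E) ℂ} {ℓ : ℕ}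
    (h : IsExtractable ε ρ ℓ) {x : ℝ} (hx : x ≤ Real.logb b ℓ) :
    (x : EReal) ≤ elogb b (maxKeySize ε ρ) := by
  refine (EReal.coe_le_coe_iff.mpr hx).trans ?_
  rw [← elogb_natCast b h.1]
  exact elogb_mono hb (le_iSup₂_of_le ℓ h le_rfl)

theorem smoothMinEntropy_sub_le {b : ℝ} (hb : 1 < b) {ρ : Matrix (Z × E) (Z × E) ℂ}
    (hρ : IsSubnormalized ρ) {ε δ : ℝ} (hδ : 0 < δ) (hε : δ < ε) :
    smoothMinEntropy b ((ε - δ) / 2) ρ - ((2 * Real.logb b (1 / δ) : ℝ) : EReal) ≤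
      elogb b (maxKeySize ε ρ) := by
  have hb0 : 0 < b := by linarith
  refine (EReal.sub_le_iff_le_add (Or.inl (EReal.coe_ne_bot _))
    (Or.inl (EReal.coe_ne_top _))).mpr ?_
  refine iSup_le fun τ => iSup_le fun hτ => iSup_le fun hP => iSup_le fun σ => iSup_le fun hσ =>
    iSup_le fun t => iSup_le fun hle => ?_
  rw [← EReal.sub_le_iff_le_add (Or.inl (EReal.coe_ne_bot _)) (Or.inl (EReal.coe_ne_top _)),
    ← EReal.coe_sub]
  have hbt : 0 < b ^ t := Real.rpow_pos_of_pos hb0 t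
  have hlog : t - 2 * Real.logb b (1 / δ) = Real.logb b (δ ^ 2 * b ^ t) := by
    rw [Real.logb_mul (by positivity) hbt.ne', Real.logb_rpow hb0 hb.ne', Real.logb_pow, one_div,
      Real.logb_inv]
    push_cast
    ring
  have hx0 : 0 < δ ^ 2 * b ^ t := by positivity
  rw [hlog]
  -- Rounding up needs `⌈x⌉ ≤ x + 1 ≤ 2 x`, so `x ≥ 1`; the factor `2` is exactly the slack in `c ℓ
  -- ≤ 2 δ ^ 2`. For `x ≤ 1` the trivial key suffices.
  rcases le_total (δ ^ 2 * b ^ t) 1 with hx | hx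
  · exact le_elogb_maxKeySize hb (isExtractable_one hρ (by linarith))
      (Real.logb_le_logb_of_le hb hx0 (by exact_mod_cast hx))
  · refine le_elogb_maxKeySize hb (isExtractable_of_le hρ hτ hσ (Real.rpow_pos_of_pos hb0 _) hδ hle
      hP (Nat.ceil_pos.mpr hx0) ?_) (Real.logb_le_logb_of_le hb hx0 (Nat.le_ceil _))
    have h1 : (⌈δ ^ 2 * b ^ t⌉₊ : ℝ) ≤ 2 * (δ ^ 2 * b ^ t) := by
      linarith [(Nat.ceil_lt_add_one hx0.le).le]
    refine (mul_le_mul_of_nonneg_left h1 (Real.rpow_pos_of_pos hb0 (-t)).le).trans_eq ?_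
    rw [Real.rpow_neg hb0.le]
    field_simp

theorem IsExtractable.logb_le_smoothMinEntropy {b : ℝ} (hb : 1 < b)
    {ρ : Matrix (Z × E) (Z × E) ℂ} (hρ : IsSubnormalized ρ) (hcl : IsClassicalLeft ρ) {ε : ℝ}
    (hε : ε ≤ 1) {ℓ : ℕ} (h : IsExtractable ε ρ ℓ) :
    ((Real.logb b ℓ : ℝ) : EReal) ≤ smoothMinEntropy b √(2 * ε - ε ^ 2) ρ := by
  obtain ⟨hℓ, P, hP⟩ := h
  have : Nonempty (Fin ℓ) := ⟨⟨0, hℓ⟩⟩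
  obtain ⟨τ, hτ, hd, hle⟩ := hP.exists_smoothed hρ hcl hε
  have hσ : IsSubnormalized (marginalRight ρ) :=
    ⟨nonneg_iff_posSemidef.mp (marginalRight_nonneg hρ.nonneg),
      (congrArg Complex.re (trace_marginalRight ρ)).trans_le hρ.2⟩
  have hpow : ((b ^ (-Real.logb b ℓ) : ℝ) : ℂ) = (Fintype.card (Fin ℓ) : ℂ)⁻¹ := by
    rw [Real.rpow_neg (by linarith), Real.rpow_logb (by linarith) hb.ne' (by exact_mod_cast hℓ)]
    simp
  exact le_iSup₂_of_le τ hτ (le_iSup_of_le hd (le_iSup₂_of_le (marginalRight ρ) hσ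
    (le_iSup₂_of_le (Real.logb b ℓ) (by rwa [hpow]) le_rfl)))

theorem isGreatest_sSup_isExtractable {ρ : Matrix (Z × E) (Z × E) ℂ} (hρ : IsSubnormalized ρ)
    {ε : ℝ} (hε : 0 ≤ ε) (hbdd : BddAbove {ℓ : ℕ | IsExtractable ε ρ ℓ}) :
    IsGreatest {ℓ : ℕ | IsExtractable ε ρ ℓ} (sSup {ℓ : ℕ | IsExtractable ε ρ ℓ}) :=
  ⟨Nat.sSup_mem ⟨1, isExtractable_one hρ hε⟩ hbdd, fun _ h => le_csSup hbdd h⟩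

theorem maxKeySize_eq {ρ : Matrix (Z × E) (Z × E) ℂ} {ε : ℝ} {L : ℕ}
    (h : IsGreatest {ℓ : ℕ | IsExtractable ε ρ ℓ} L) : maxKeySize ε ρ = (L : ℕ∞) :=
  le_antisymm (iSup₂_le fun _ hℓ => by exact_mod_cast h.2 hℓ) (le_iSup₂_of_le L h.1 le_rfl)

theorem elogb_maxKeySize_le {b : ℝ} (hb : 1 < b) {ρ : Matrix (Z × E) (Z × E) ℂ}
    (hρ : IsSubnormalized ρ) (hcl : IsClassicalLeft ρ) {ε : ℝ} (hε0 : 0 ≤ ε) (hε : ε ≤ 1) :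
    elogb b (maxKeySize ε ρ) ≤ smoothMinEntropy b √(2 * ε - ε ^ 2) ρ := by
  by_cases hbdd : BddAbove {ℓ : ℕ | IsExtractable ε ρ ℓ}
  · have h := isGreatest_sSup_isExtractable hρ hε0 hbdd
    rw [maxKeySize_eq h, elogb_natCast b h.1.1]
    exact h.1.logb_le_smoothMinEntropy hb hρ hcl hε
  -- If key sizes are unbounded, their logarithms exceed every real and each is below the smooth
  -- min-entropy, which is therefore `⊤`.
  · refine le_top.trans_eq (EReal.eq_top_iff_forall_lt _ |>.mpr fun y => ?_).symm
    obtain ⟨ℓ, hℓ, hlt⟩ := not_bddAbove_iff.mp hbdd ⌈b ^ y⌉₊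
    have hlt' : b ^ y < ℓ := (Nat.le_ceil _).trans_lt (by exact_mod_cast hlt)
    refine lt_of_lt_of_le ?_ (hℓ.logb_le_smoothMinEntropy hb hρ hcl hε)
    rw [EReal.coe_lt_coe_iff, Real.lt_logb_iff_rpow_lt hb (by exact_mod_cast hℓ.1)]
    exact hlt'

theorem bddAbove_isExtractable {ρ : Matrix (Z × E) (Z × E) ℂ} (hρ : IsSubnormalized ρ) {ε : ℝ}
    (hε : ε < ρ.trace.re) : BddAbove {ℓ : ℕ | IsExtractable ε ρ ℓ} := by
  refine ⟨⌊Fintype.card Z * ρ.trace.re / (ρ.trace.re - ε)⌋₊, ?_⟩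
  rintro ℓ ⟨hℓ, P, hP⟩
  have : Nonempty (Fin ℓ) := ⟨⟨0, hℓ⟩⟩
  have h := hP.card_mul_le hρ.nonneg
  rw [Fintype.card_fin, ← le_div_iff₀ (by linarith)] at h
  exact Nat.le_floor h

end QInfo

theorem mainTheorem9 {Z E : Type*} [Fintype Z] [DecidableEq Z] [Fintype E] [DecidableEq E]
    (b : ℝ) (hb : 1 < b) (ρ : Matrix (Z × E) (Z × E) ℂ) (hρ : QInfo.IsSubnormalized ρ)
    (hcl : QInfo.IsClassicalLeft ρ) (ε : ℝ) (hε : ε ∈ Set.Ioo (0 : ℝ) 1) :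
    (∀ δ ∈ Set.Ioo (0 : ℝ) ε,
      QInfo.smoothMinEntropy b ((ε - δ) / 2) ρ - ((2 * Real.logb b (1 / δ) : ℝ) : EReal) ≤
        QInfo.elogb b (QInfo.maxKeySize ε ρ)) ∧
    QInfo.elogb b (QInfo.maxKeySize ε ρ) ≤
      QInfo.smoothMinEntropy b (Real.sqrt (2 * ε - ε ^ 2)) ρ ∧
    (ε < ρ.trace.re →
      ∃ L : ℕ, IsGreatest {ℓ : ℕ | QInfo.IsExtractable ε ρ ℓ} L ∧
        QInfo.maxKeySize ε ρ = (L : ℕ∞)) := by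
  refine ⟨fun δ hδ => QInfo.smoothMinEntropy_sub_le hb hρ hδ.1 hδ.2,
    QInfo.elogb_maxKeySize_le hb hρ hcl hε.1.le hε.2.le, fun h => ?_⟩
  have hL := QInfo.isGreatest_sSup_isExtractable hρ hε.1.le (QInfo.bddAbove_isExtractable hρ h)
  exact ⟨_, hL, QInfo.maxKeySize_eq hL⟩
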